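/- Let $\mathbb F_q$ be a finite field, $k=\mathbb F_q(\theta)$, $k_\infty=\mathbb F_q((1/\theta))$, $\overline{k_\infty}$ an algebraic closure of $k_\infty$, $\bar k$ the algebraic closure of $k$ in $\overline{k_\infty}$, and $\mathbb C_\infty$ the completion of $\overline{k_\infty}$ for the absolute value $|\cdot|_\infty$ with $|\theta|_\infty=q$. Fix $\tilde\theta$ with $\tilde\theta^{\,q-1}=-\theta$ and put $\Omega(t)=\tilde\theta^{-q}\prod_{i\ge1}\bigl(1-t/\theta^{q^i}\bigr)$, $\tilde\pi=1/\Omega(\theta)$. For $n\in\mathbb Z$ and $f=\sum_i a_it^i\in\mathbb C_\infty[[t]]$ let $f^{(n)}=\sum_i a_i^{q^n}t^i$ (entrywise on vectors). Let $\mathcal E$ be the ring of power series $\sum_n a_nt^n\in\bar k[[t]]$ with $|a_n|_\infty^{1/n}\to0$ and $[k_\infty(a_0,a_1,\dots):k_\infty]<\infty$. A nonzero $Z\in\overline{k_\infty}$ has the MZ property with weight $w$ if there are $d\ge2$, $\Phi\in\mathrm{Mat}_d(\bar k[t])$, $\psi\in\mathrm{Mat}_{d\times1}(\mathcal E)$ and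 $c\in k^\times$ such that (1) $\psi^{(-1)}=\Phi\psi$, and $\det\Phi=b(t-\theta)^m$ for some $b\in\bar k^\times$ and some integer $m\ge0$; (2) the last column of $\Phi$ is $(0,\dots,0,1)^{\mathrm{tr}}$; (3) the first entry of $\psi(\theta)$ is $1/\tilde\pi^{w}$ and its last entry is $cZ/\tilde\pi^{w}$; (4) for every integer $N\ge1$, $\psi(\theta^{q^N})=\bigl(0,\dots,0,(cZ/\tilde\pi^{w})^{q^N}\bigr)^{\mathrm{tr}}$. Let $r\ge1$, let $\mathfrak s=(s_1,\dots,s_r)$ be positive integers, put $\mathcal L_i=\prod_{j=1}^{i}(\theta-\theta^{q^j})$ (so $\mathcal L_0=1$) and $$\mathrm{Li}_{\mathfrak s}(z_1,\dots,z_r)=\sum_{i_1>\cdots>i_r\ge0}\frac{z_1^{q^{i_1}}\cdots z_r^{q^{i_r}}}{\mathcal L_{i_1}^{s_1}\cdots\mathcal L_{i_r}^{s_r}},$$ and let $\mathbb D_{\mathfrak s}\subseteq\mathbb C_\infty^r$ be the set of points at which this series converges. Proposition. If $\mathbf u=(u_1,\dots,u_r)\in\mathbb D_{\mathfrak s}\cap(\bar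 k^\times)^r$ and $\mathrm{Li}_{\mathfrak s}(\mathbf u)\ne0$, then $\mathrm{Li}_{\mathfrak s}(\mathbf u)$ has the MZ property with weight $s_1+\cdots+s_r$. -/

import Mathlib

noncomputable section

namespace CarlitzMZ

open scoped NNReal
open Filter Topology

/-! ### The fields `k ⊆ k_∞ ⊆ K̄_∞ ⊆ ℂ_∞` and the absolute value

Here `F = 𝔽_q`, `q = Fintype.card F`, and `k = 𝔽_q(θ)` is `RatFunc F` with `θ = RatFunc.X`. -/

section Fields

variable (F : Type*) [Field F]

/-- `k_∞ = 𝔽_q((1/θ))`, the completion of `k` at the place at infinity. -/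
abbrev KInf := @RatFunc.CompletionAtInfty F _ (Classical.decEq _)

/-- The fixed algebraic closure of `k_∞`. -/
abbrev KInfBar := AlgebraicClosure (KInf F)

instance KInf.instCompleteSpace : CompleteSpace (KInf F) :=
  letI := Classical.decEq (RatFunc F)
  letI : UniformSpace (RatFunc F) := (RatFunc.inftyValued F).toUniformSpace
  inferInstanceAs (CompleteSpace (UniformSpace.Completion (RatFunc F)))

theorem valued_theta :
    (Valued.v (algebraMap (RatFunc F) (KInf F) RatFunc.X) : WithZero (Multiplicative ℤ)) =
      WithZero.exp 1 := by
  let _ := Classical.decEq (RatFunc F)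
  let _ := RatFunc.inftyValued F
  have h := Valued.extensionValuation_apply_coe (K := RatFunc F) RatFunc.X
  exact h.trans (RatFunc.inftyValuation.X F)

variable [Fintype F]

theorem one_lt_card : (1 : ℝ≥0) < (Fintype.card F : ℝ≥0) := by
  exact_mod_cast Fintype.one_lt_card

/-- The valuation at infinity is turned into an absolute value by `exp n ↦ q ^ n`. -/
instance KInf.instRankOne : (Valued.v : Valuation (KInf F) (WithZero (Multiplicative ℤ))).RankOne where
  hom' := (WithZeroMulInt.toNNReal (one_lt_card F).ne_zero).comp
    MonoidWithZeroHom.ValueGroup₀.embedding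
  strictMono' := (WithZeroMulInt.toNNReal_strictMono (one_lt_card F)).comp
    MonoidWithZeroHom.ValueGroup₀.embedding_strictMono
  exists_val_nontrivial := by
    refine ⟨algebraMap (RatFunc F) (KInf F) RatFunc.X, ?_⟩
    rw [valued_theta]
    exact ⟨WithZero.exp_ne_zero, fun h => by simp at h⟩

/-- `|·|_∞` on `k_∞`, normalised by `|θ|_∞ = q`. -/
instance KInf.instNontriviallyNormedField : NontriviallyNormedField (KInf F) := Valued.toNontriviallyNormedField (KInf F) _

instance KInf.instIsUltrametricDist : IsUltrametricDist (KInf F) := Valued.instIsUltrametricDist _ _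

/-- The unique extension of `|·|_∞` to the algebraic closure of `k_∞`. -/
instance KInfBar.instNormedField : NormedField (KInfBar F) :=
  spectralNorm.normedField (KInf F) (KInfBar F)

instance KInfBar.instNormedAlgebra : NormedAlgebra (KInf F) (KInfBar F) :=
  spectralNorm.normedAlgebra _ _

instance KInfBar.instUniformContinuousConstSMul : UniformContinuousConstSMul (KInf F) (KInfBar F) :=
  uniformContinuousConstSMul_of_continuousConstSMul _ _

instance KInfBar.instUniformContinuousConstSMulRatFunc :
    UniformContinuousConstSMul (RatFunc F) (KInfBar F) where
  uniformContinuous_const_smul c := by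
    simp only [Algebra.smul_def]
    exact uniformContinuous_const_smul (algebraMap (RatFunc F) (KInfBar F) c)

/-- `ℂ_∞`, the completion of the algebraic closure of `k_∞`, with the extended absolute value. -/
abbrev CInf := UniformSpace.Completion (KInfBar F)

instance CInf.instIsScalarTower : IsScalarTower (RatFunc F) (KInfBar F) (CInf F) :=
  IsScalarTower.of_algebraMap_eq fun _ => rfl

/-- `θ` as an element of `ℂ_∞`. -/
def theta : CInf F := algebraMap (RatFunc F) (CInf F) RatFunc.X

theorem norm_theta : ‖theta F‖ = Fintype.card F := by
  have h1 : ‖theta F‖ = ‖algebraMap (RatFunc F) (KInf F) RatFunc.X‖ := by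
    have : theta F = algebraMap (KInf F) (CInf F) (algebraMap (RatFunc F) (KInf F) RatFunc.X) := by
      rw [IsScalarTower.algebraMap_apply (KInf F) (KInfBar F) (CInf F),
        ← IsScalarTower.algebraMap_apply (RatFunc F) (KInf F) (KInfBar F)]
      rfl
    rw [this, norm_algebraMap']
  rw [h1, Valued.toNormedField.norm_def]
  change ((WithZeroMulInt.toNNReal (one_lt_card F).ne_zero
    (MonoidWithZeroHom.ValueGroup₀.embedding (Valued.v.restrict _)) : ℝ≥0) : ℝ) = _
  rw [Valuation.embedding_restrict, valued_theta,
    WithZeroMulInt.toNNReal_neg_apply _ WithZero.exp_ne_zero]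
  simp [WithZero.exp]

/-- `k̄`: the algebraic closure of `k` in the algebraic closure of `k_∞`, viewed inside `ℂ_∞`. -/
def kBar : IntermediateField (RatFunc F) (CInf F) :=
  (algebraicClosure (RatFunc F) (KInfBar F)).map
    (IsScalarTower.toAlgHom (RatFunc F) (KInfBar F) (CInf F))

end Fields

/-! ### Twisting -/

section Twist

variable (F : Type*) [Field F] [Fintype F]

/-- The ring endomorphism `x ↦ x ^ q` of `ℂ_∞`. -/
def frobHom : CInf F →+* CInf F :=
  letI : Algebra F (CInf F) :=
    ((algebraMap (RatFunc F) (CInf F)).comp (algebraMap F (RatFunc F))).toAlgebra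
  (FiniteField.frobeniusAlgHom F (CInf F)).toRingHom

theorem frobHom_apply (x : CInf F) : frobHom F x = x ^ Fintype.card F := rfl

theorem frobHom_bijective : Function.Bijective (frobHom F) := by
  have hq : Fintype.card F ≠ 0 := Fintype.card_ne_zero
  have hd : ∀ x y, dist (frobHom F x) (frobHom F y) = dist x y ^ Fintype.card F := fun x y => by
    rw [dist_eq_norm, ← map_sub, frobHom_apply, norm_pow, dist_eq_norm]
  refine ⟨(frobHom F).injective, ?_⟩
  have hc : Continuous (frobHom F) := by
    change Continuous fun x : CInf F => x ^ Fintype.card F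
    fun_prop
  have hu : IsUniformInducing (frobHom F) := by
    rw [Metric.isUniformInducing_iff]
    refine ⟨uniformContinuous_addMonoidHom_of_continuous (f := (frobHom F).toAddMonoidHom) hc, ?_⟩
    intro δ hδ
    refine ⟨δ ^ Fintype.card F, by positivity, fun {a b} h => ?_⟩
    rw [hd] at h
    exact lt_of_pow_lt_pow_left₀ _ hδ.le h
  have hcl : IsClosed (Set.range (frobHom F)) := by
    exact hu.isComplete_range.isClosed
  have hr : Set.range ((↑) : KInfBar F → CInf F) ⊆ Set.range (frobHom F) := by
    rintro _ ⟨y, rfl⟩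
    obtain ⟨z, hz⟩ := IsAlgClosed.exists_pow_nat_eq y (Nat.pos_of_ne_zero hq)
    refine ⟨algebraMap (KInfBar F) (CInf F) z, ?_⟩
    rw [frobHom_apply, ← map_pow, hz]
    rfl
  intro x
  exact hcl.closure_subset_iff.2 hr
    ((UniformSpace.Completion.denseRange_coe (α := KInfBar F)).closure_range ▸ Set.mem_univ x)

/-- The automorphism `x ↦ x ^ q` of `ℂ_∞`. -/
def frob : RingAut (CInf F) := RingEquiv.ofBijective (frobHom F) (frobHom_bijective F)

variable {F}

/-- The `n`-fold twist `∑ aᵢ tⁱ ↦ ∑ aᵢ ^ (q ^ n) tⁱ`, for an integer `n`. -/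
def twist (n : ℤ) (f : PowerSeries (CInf F)) : PowerSeries (CInf F) :=
  PowerSeries.map ((frob F ^ n : RingAut (CInf F)) : CInf F →+* CInf F) f

end Twist

/-! ### Entire functions, the Carlitz period and the MZ property -/

section MZ

variable {F : Type*} [Field F] [Fintype F]

/-- Membership in the ring `𝓔` of entire functions: coefficients in `k̄`, `|aₙ|^(1/n) → 0`, and
`[k_∞(a₀, a₁, …) : k_∞] < ∞`. -/
structure IsEntire (f : PowerSeries (CInf F)) : Prop where
  coeff_mem : ∀ n, PowerSeries.coeff n f ∈ kBar F
  tendsto : Tendsto (fun n : ℕ => ‖PowerSeries.coeff n f‖ ^ (1 / (n : ℝ))) atTop (𝓝 0)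
  finite : FiniteDimensional (KInf F)
    (IntermediateField.adjoin (KInf F) (Set.range fun n => PowerSeries.coeff n f))

/-- The value at `x` of a power series (used for entire ones, which converge everywhere). -/
def evalAt (f : PowerSeries (CInf F)) (x : CInf F) : CInf F :=
  ∑' n, PowerSeries.coeff n f * x ^ n

/-- `Ω(t) = θ̃^(-q) ∏_{i ≥ 1} (1 - t / θ^(q^i))`, for a given `(q-1)`-th root `θ̃` of `-θ`. -/
def Omega (θ' t : CInf F) : CInf F :=
  (θ' ^ Fintype.card F)⁻¹ * ∏' i : ℕ, (1 - t / theta F ^ Fintype.card F ^ (i + 1))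

/-- The Carlitz period `π̃ = 1 / Ω(θ)`. -/
def carlitzPeriod (θ' : CInf F) : CInf F := 1 / Omega θ' (theta F)

/-- The system `ψ^(-1) = Φ ψ`, of size `n + 1`, exhibits the MZ property with weight `w` of `Z`,
with the constant `c`. -/
structure IsMZSystem (θ' : CInf F) (w : ℕ) (Z : CInf F) {n : ℕ}
    (Φ : Matrix (Fin (n + 1)) (Fin (n + 1)) (Polynomial (CInf F)))
    (ψ : Fin (n + 1) → PowerSeries (CInf F)) (c : RatFunc F) : Prop where
  coeff_mem : ∀ i j m, (Φ i j).coeff m ∈ kBar F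
  entire : ∀ i, IsEntire (ψ i)
  twist_eq : (fun i => twist (-1) (ψ i)) =
    (Φ.map fun p => (p : PowerSeries (CInf F))).mulVec ψ
  det_eq : ∃ b ∈ kBar F, b ≠ 0 ∧ ∃ m : ℕ,
    Φ.det = Polynomial.C b * (Polynomial.X - Polynomial.C (theta F)) ^ m
  last_col : ∀ i, Φ i (Fin.last n) = if i = Fin.last n then 1 else 0
  c_ne_zero : c ≠ 0
  eval_first : evalAt (ψ 0) (theta F) = 1 / carlitzPeriod θ' ^ w
  eval_last : evalAt (ψ (Fin.last n)) (theta F) =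
    algebraMap (RatFunc F) (CInf F) c * Z / carlitzPeriod θ' ^ w
  eval_twist : ∀ N : ℕ, 1 ≤ N → ∀ i,
    evalAt (ψ i) (theta F ^ Fintype.card F ^ N) =
      if i = Fin.last n then
        (algebraMap (RatFunc F) (CInf F) c * Z / carlitzPeriod θ' ^ w) ^ Fintype.card F ^ N
      else 0

/-- A nonzero element `Z` of the algebraic closure of `k_∞` has the MZ property with weight `w`:
there is a system as above of some size `d = n + 1 ≥ 2`. -/
def HasMZProperty (θ' : CInf F) (w : ℕ) (Z : CInf F) : Prop :=
  Z ≠ 0 ∧ Z ∈ Set.range (algebraMap (KInfBar F) (CInf F)) ∧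
    ∃ n : ℕ, 1 ≤ n ∧
      ∃ (Φ : Matrix (Fin (n + 1)) (Fin (n + 1)) (Polynomial (CInf F)))
        (ψ : Fin (n + 1) → PowerSeries (CInf F)) (c : RatFunc F), IsMZSystem θ' w Z Φ ψ c

end MZ

/-! ### Carlitz multiple polylogarithms -/

section CMPL

variable {F : Type*} [Field F] [Fintype F]

variable (F) in
/-- `𝓛_i = ∏_{j=1}^{i} (θ - θ^(q^j))`. -/
def ell (i : ℕ) : CInf F := ∏ j ∈ Finset.Icc 1 i, (theta F - theta F ^ Fintype.card F ^ j)

/-- The index set `i₁ > ⋯ > i_r ≥ 0`. -/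
abbrev DecIndex (r : ℕ) := {i : Fin r → ℕ // StrictAnti i}

/-- The general term of the series `Li_𝔰(u)`. -/
def liTerm {r : ℕ} (s : Fin r → ℕ) (u : Fin r → CInf F) (i : DecIndex r) : CInf F :=
  (∏ j, u j ^ Fintype.card F ^ i.1 j) / ∏ j, ell F (i.1 j) ^ s j

/-- The convergence domain `𝔻_𝔰`. Convergence of this multiple series is unconditional: over the
complete nonarchimedean field `ℂ_∞` it means that the terms tend to `0` as `i₁ → ∞`. -/
def convDomain {r : ℕ} (s : Fin r → ℕ) : Set (Fin r → CInf F) := {u | Summable (liTerm s u)}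

/-- The Carlitz multiple polylogarithm `Li_𝔰(u)`. -/
def Li {r : ℕ} (s : Fin r → ℕ) (u : Fin r → CInf F) : CInf F := ∑' i, liTerm s u i

end CMPL

end CarlitzMZ

end

/-! Write `f⁽¹⁾` for the twist of `f` and `a = θ̃^(-q)`. The function `Ω` satisfies `Ω = (t - θ^q)
Ω⁽¹⁾`, so it vanishes at `θ^(q^N)` for `N ≥ 1`, and `Ω⁽ⁱ⁾(θ) = Ω(θ) / 𝓛_i`. Define `L_0 = 1` and
`L_{j+1} = Ω^{s_j} u_j L_j⁽¹⁾ + L_{j+1}⁽¹⁾`. Unrolling the recursion at `t = θ` gives the nested sum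
for the polylogarithm, so `L_r(θ) = Ω(θ)^w Li(u)` with `w = ∑ s_k`. At `t = θ^(q^(N+1))` the term
containing `Ω` vanishes, whence `L_{j+1}(θ^(q^N)) = L_{j+1}(θ)^(q^N)`. With `S_i = s_i + ⋯ +
s_{r-1}`, the vector `ψ_i = Ω^{S_i} L_i` therefore has the required values with `c = 1`, and
untwisting the two functional equations gives a lower bidiagonal `Φ` whose diagonal entries are
powers of `t - θ`.

Both `Ω` and `L_{j+1}` are fixed points of an operator `f ↦ h + p f⁽¹⁾`. Twisting raises norms to
the power `q`, so the iterates converge as soon as the first correction is small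
(`twistedFixedPoint_spec`). For `L_{j+1}` smallness means that `polylogBound` is `< 1`, and this is
extracted from convergence of the series at a point with nonzero coordinates
(`polylogBound_lt_one`), by letting the first indices tend to infinity together.

Membership in `𝓔` also comes from the fixed point equation. Boundedness on one disc of radius `> 1`
spreads to every disc. Each coefficient solves `x = β + α x^q` with `α`, `β` in `k̄`, hence is
algebraic. It is also a limit of coefficients of iterates, which stay in one finite extension of
`k_∞`; such an extension is closed. -/

namespace CarlitzMZ

open Filter Topology

/-! ### Gauss norm bounds of power series over an ultrametric field -/

section Gauss

variable {K : Type*} [NormedField K]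

/-- The Gauss norm of `f` on the disc of radius `R` is at most `B`. -/
def GaussBound (R B : ℝ) (f : PowerSeries K) : Prop :=
  ∀ n, ‖PowerSeries.coeff n f‖ * R ^ n ≤ B

/-- `f` has a finite Gauss norm on every disc. -/
def GaussFinite (f : PowerSeries K) : Prop := ∀ R : ℝ, 0 ≤ R → ∃ B, GaussBound R B f

namespace GaussBound

variable {R A B : ℝ} {f g : PowerSeries K}

theorem nonneg (hf : GaussBound R B f) : 0 ≤ B := by
  have := hf 0
  rw [pow_zero, mul_one] at this
  exact (norm_nonneg _).trans this

theorem mono (hf : GaussBound R A f) (h : A ≤ B) : GaussBound R B f := fun n => (hf n).trans h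

theorem mono_radius {R' : ℝ} (hf : GaussBound R B f) (h0 : 0 ≤ R') (h : R' ≤ R) :
    GaussBound R' B f := fun n =>
  (mul_le_mul_of_nonneg_left (pow_le_pow_left₀ h0 h n) (norm_nonneg _)).trans (hf n)

theorem zero (hB : 0 ≤ B) : GaussBound R B (0 : PowerSeries K) := fun n => by simpa using hB

theorem C (a : K) : GaussBound R ‖a‖ (PowerSeries.C a) := fun n => by
  rcases n with _ | n
  · simp
  · simp

theorem X (hR : 0 ≤ R) : GaussBound R R (PowerSeries.X : PowerSeries K) := fun n => by
  rw [PowerSeries.coeff_X]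
  split_ifs with h
  · simp [h]
  · simpa using hR

theorem neg (hf : GaussBound R B f) : GaussBound R B (-f) := fun n => by
  simpa using hf n

theorem eq_zero (hR : 0 < R) {u : ℕ → ℝ} (hu : Tendsto u atTop (𝓝 0))
    (hf : ∀ N, GaussBound R (u N) f) : f = 0 := by
  ext n
  have : ‖PowerSeries.coeff n f‖ * R ^ n ≤ 0 := ge_of_tendsto' hu fun N => hf N n
  rw [map_zero, ← norm_le_zero_iff]
  exact nonpos_of_mul_nonpos_left this (pow_pos hR n)

variable [IsUltrametricDist K]

theorem add (hR : 0 ≤ R) (hf : GaussBound R B f) (hg : GaussBound R B g) :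
    GaussBound R B (f + g) := fun n => by
  rw [map_add]
  refine (mul_le_mul_of_nonneg_right (IsUltrametricDist.norm_add_le_max _ _)
    (pow_nonneg hR n)).trans ?_
  rw [max_mul_of_nonneg _ _ (pow_nonneg hR n)]
  exact max_le (hf n) (hg n)

theorem sub (hR : 0 ≤ R) (hf : GaussBound R B f) (hg : GaussBound R B g) :
    GaussBound R B (f - g) := by
  rw [sub_eq_add_neg]
  exact hf.add hR hg.neg

theorem mul (hR : 0 ≤ R) (hf : GaussBound R A f) (hg : GaussBound R B g) :
    GaussBound R (A * B) (f * g) := fun n => by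
  -- The main argument divides by `R ^ n`; at radius `0` only the constant coefficient counts.
  rcases hR.eq_or_lt with rfl | hR
  · rcases n with _ | n
    · have h1 := hf 0
      have h2 := hg 0
      rw [pow_zero, mul_one] at *
      rw [PowerSeries.coeff_zero_eq_constantCoeff_apply] at *
      rw [map_mul, norm_mul]
      exact mul_le_mul h1 h2 (norm_nonneg _) hf.nonneg
    · simpa using mul_nonneg hf.nonneg hg.nonneg
  · rw [PowerSeries.coeff_mul, ← le_div_iff₀ (pow_pos hR n)]
    refine IsUltrametricDist.norm_sum_le_of_forall_le_of_nonneg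
      (div_nonneg (mul_nonneg hf.nonneg hg.nonneg) (pow_pos hR n).le) fun p hp => ?_
    rw [le_div_iff₀ (pow_pos hR n), ← Finset.HasAntidiagonal.mem_antidiagonal.1 hp, pow_add, norm_mul,
      mul_mul_mul_comm]
    exact mul_le_mul (hf _) (hg _) (mul_nonneg (norm_nonneg _) (pow_pos hR _).le) hf.nonneg

theorem pow (hR : 0 ≤ R) (hf : GaussBound R A f) (n : ℕ) : GaussBound R (A ^ n) (f ^ n) := by
  induction n with
  | zero => simpa using GaussBound.C (R := R) (1 : K)
  | succ n ih => rw [pow_succ, pow_succ]; exact ih.mul hR hf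

end GaussBound

namespace GaussFinite

variable {f g : PowerSeries K}

theorem C (a : K) : GaussFinite (PowerSeries.C a) := fun _ _ => ⟨_, GaussBound.C a⟩

theorem X : GaussFinite (PowerSeries.X : PowerSeries K) := fun _ hR => ⟨_, GaussBound.X hR⟩

theorem one : GaussFinite (1 : PowerSeries K) := by simpa using C (1 : K)

theorem summable_norm (hf : GaussFinite f) (x : K) :
    Summable fun n => ‖PowerSeries.coeff n f * x ^ n‖ := by
  -- Doubling the radius leaves a geometric series of ratio `1/2`.
  obtain ⟨B, hB⟩ := hf (2 * ‖x‖) (by positivity)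
  refine Summable.of_nonneg_of_le (fun n => norm_nonneg _) (fun n => ?_)
    ((summable_geometric_two).mul_left B)
  rw [norm_mul, norm_pow, one_div, inv_pow, ← div_eq_mul_inv, le_div_iff₀ (by positivity),
    mul_assoc, mul_comm (‖x‖ ^ n), ← mul_pow]
  exact hB n

theorem tendsto_rpow (hf : GaussFinite f) :
    Tendsto (fun n : ℕ => ‖PowerSeries.coeff n f‖ ^ (1 / (n : ℝ))) atTop (𝓝 0) := by
  rw [Metric.tendsto_atTop]
  intro ε hε
  -- Radius `4/ε` bounds the coefficient by `B (ε/4)^n`, which is at most `(ε/2)^n` once `B ≤ 2^n`.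
  obtain ⟨B, hB⟩ := hf (4 / ε) (by positivity)
  obtain ⟨N, hN⟩ := pow_unbounded_of_one_lt B (one_lt_two)
  refine ⟨max N 1, fun n hn => ?_⟩
  have hn0 : n ≠ 0 := by have := le_trans (le_max_right _ _) hn; omega
  have hBn : B ≤ 2 ^ n := hN.le.trans
    (pow_le_pow_right₀ one_le_two ((le_max_left _ _).trans hn))
  have h1 : ‖PowerSeries.coeff n f‖ ≤ (ε / 2) ^ n := by
    have h2 := (hB n).trans hBn
    rw [← le_div_iff₀ (by positivity), ← div_pow] at h2
    have h3 : 2 / (4 / ε) = ε / 2 := by rw [div_div_eq_mul_div]; ring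
    rwa [h3] at h2
  rw [dist_zero_right, Real.norm_of_nonneg (Real.rpow_nonneg (norm_nonneg _) _)]
  calc _ ≤ ((ε / 2) ^ n) ^ (1 / (n : ℝ)) :=
        Real.rpow_le_rpow (norm_nonneg _) h1 (by positivity)
    _ = ε / 2 := by
        rw [one_div, Real.pow_rpow_inv_natCast (by positivity) hn0]
    _ < ε := by linarith

theorem neg (hf : GaussFinite f) : GaussFinite (-f) := fun R hR =>
  (hf R hR).imp fun _ h => h.neg

variable [IsUltrametricDist K]

theorem add (hf : GaussFinite f) (hg : GaussFinite g) : GaussFinite (f + g) := fun R hR => by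
  obtain ⟨A, hA⟩ := hf R hR
  obtain ⟨B, hB⟩ := hg R hR
  exact ⟨max A B, (hA.mono (le_max_left _ _)).add hR (hB.mono (le_max_right _ _))⟩

theorem sub (hf : GaussFinite f) (hg : GaussFinite g) : GaussFinite (f - g) := by
  rw [sub_eq_add_neg]
  exact hf.add hg.neg

theorem mul (hf : GaussFinite f) (hg : GaussFinite g) : GaussFinite (f * g) := fun R hR => by
  obtain ⟨A, hA⟩ := hf R hR
  obtain ⟨B, hB⟩ := hg R hR
  exact ⟨_, hA.mul hR hB⟩

theorem pow (hf : GaussFinite f) (n : ℕ) : GaussFinite (f ^ n) := fun R hR => by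
  obtain ⟨A, hA⟩ := hf R hR
  exact ⟨_, hA.pow hR n⟩

theorem prod {ι : Type*} (s : Finset ι) {f : ι → PowerSeries K} (hf : ∀ i, GaussFinite (f i)) :
    GaussFinite (∏ i ∈ s, f i) :=
  Finset.prod_induction _ GaussFinite (fun _ _ => mul) one fun i _ => hf i

end GaussFinite

/-! ### Twisted fixed points -/

variable {σ : K →+* K} {q : ℕ}

theorem GaussBound.map (hσ : ∀ x, ‖σ x‖ = ‖x‖ ^ q) {R B : ℝ} {f : PowerSeries K} (hR : 0 ≤ R)
    (hf : GaussBound R B f) : GaussBound (R ^ q) (B ^ q) (PowerSeries.map σ f) := fun n => by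
  rw [PowerSeries.coeff_map, hσ, pow_right_comm, ← mul_pow]
  exact pow_le_pow_left₀ (mul_nonneg (norm_nonneg _) (pow_nonneg hR n)) (hf n) q

theorem GaussBound.map_same (hσ : ∀ x, ‖σ x‖ = ‖x‖ ^ q) (hq : q ≠ 0) {R B : ℝ}
    {f : PowerSeries K} (hR : 1 ≤ R) (hf : GaussBound R B f) :
    GaussBound R (B ^ q) (PowerSeries.map σ f) :=
  (hf.map hσ (zero_le_one.trans hR)).mono_radius (zero_le_one.trans hR) (le_self_pow₀ hR hq)

theorem GaussBound.map_iterate (hσ : ∀ x, ‖σ x‖ = ‖x‖ ^ q) (hq : q ≠ 0) {R B : ℝ}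
    {f : PowerSeries K} (hR : 1 ≤ R) (hf : GaussBound R B f) (n : ℕ) :
    GaussBound R (B ^ q ^ n) ((PowerSeries.map σ)^[n] f) := by
  induction n with
  | zero => simpa using hf
  | succ n ih =>
    rw [Function.iterate_succ_apply', pow_succ, pow_mul]
    exact ih.map_same hσ hq hR

theorem GaussFinite.map (hσ : ∀ x, ‖σ x‖ = ‖x‖ ^ q) (hq : q ≠ 0) {f : PowerSeries K}
    (hf : GaussFinite f) : GaussFinite (PowerSeries.map σ f) := fun R hR => by
  obtain ⟨B, hB⟩ := hf (max R 1) (by positivity)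
  exact ⟨_, (hB.map_same hσ hq (le_max_right _ _)).mono_radius hR (le_max_left _ _)⟩

theorem GaussFinite.map_iterate (hσ : ∀ x, ‖σ x‖ = ‖x‖ ^ q) (hq : q ≠ 0) {f : PowerSeries K}
    (hf : GaussFinite f) (n : ℕ) : GaussFinite ((PowerSeries.map σ)^[n] f) := by
  induction n with
  | zero => simpa using hf
  | succ n ih => rw [Function.iterate_succ_apply']; exact ih.map hσ hq

/-- The affine operator `f ↦ h + p f⁽¹⁾`. -/
noncomputable def twistedAffine (σ : K →+* K) (h p f : PowerSeries K) : PowerSeries K :=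
  h + p * PowerSeries.map σ f

/-- The coefficientwise limit of a sequence of power series. -/
noncomputable def coeffLim (f : ℕ → PowerSeries K) : PowerSeries K :=
  PowerSeries.mk fun n => limUnder atTop fun N => PowerSeries.coeff n (f N)

variable [IsUltrametricDist K]

/-- A solution of `f = h + p f⁽¹⁾` which is bounded on a disc of radius `> 1` is bounded on every
disc. -/
theorem GaussFinite.of_twistedAffine_eq (hσ : ∀ x, ‖σ x‖ = ‖x‖ ^ q) (hq : 1 < q)
    {h p f : PowerSeries K} (hh : GaussFinite h) (hp : GaussFinite p)
    (hf : twistedAffine σ h p f = f) {R B : ℝ} (hR : 1 < R) (hB : GaussBound R B f) :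
    GaussFinite f := by
  -- A bound for `f` at radius `ρ` gives one for `f⁽¹⁾` at radius `ρ^q`, and the equation transfers
  -- it back to `f`; the radii `R^(q^n)` are unbounded.
  have key : ∀ n : ℕ, ∃ B, GaussBound (R ^ q ^ n) B f := by
    intro n
    induction n with
    | zero => exact ⟨B, by simpa using hB⟩
    | succ n ih =>
      obtain ⟨B, hB⟩ := ih
      have h0 : 0 ≤ R ^ q ^ n := by positivity
      have h0' : 0 ≤ (R ^ q ^ n) ^ q := by positivity
      obtain ⟨B₁, h₁⟩ := hh _ h0'
      obtain ⟨B₂, h₂⟩ := hp _ h0'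
      have h₃ := h₂.mul h0' (hB.map hσ h0)
      refine ⟨max B₁ (B₂ * B ^ q), ?_⟩
      rw [pow_succ, pow_mul, ← hf]
      exact (h₁.mono (le_max_left _ _)).add h0' (h₃.mono (le_max_right _ _))
  intro R' hR'
  obtain ⟨n, hn⟩ := pow_unbounded_of_one_lt R' hR
  obtain ⟨B', hB'⟩ := key n
  exact ⟨B', hB'.mono_radius hR' (hn.le.trans
    (pow_le_pow_right₀ hR.le (Nat.lt_pow_self hq).le))⟩

variable [CompleteSpace K]

theorem GaussBound.coeffLim {f : ℕ → PowerSeries K} {R : ℝ} (hR : 0 < R) {u : ℕ → ℝ}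
    (hanti : Antitone u) (hu : Tendsto u atTop (𝓝 0))
    (hf : ∀ N, GaussBound R (u N) (f (N + 1) - f N)) :
    (∀ N, GaussBound R (u N) (coeffLim f - f N)) ∧
      ∀ n, Tendsto (fun N => PowerSeries.coeff n (f N)) atTop
        (𝓝 (PowerSeries.coeff n (CarlitzMZ.coeffLim f))) := by
  -- By the ultrametric inequality, `k` steps together move no further than the largest one, and the
  -- bounds `u` decrease.
  have hd : ∀ N k, GaussBound R (u N) (f (N + k) - f N) := by
    intro N k
    induction k with
    | zero => simpa using GaussBound.zero (hf N).nonneg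
    | succ k ih =>
      rw [← sub_add_sub_cancel _ (f (N + k))]
      exact ((hf (N + k)).mono (hanti (Nat.le_add_right _ _))).add hR.le ih
  have hc : ∀ n, CauchySeq fun N => PowerSeries.coeff n (f N) := by
    intro n
    rw [Metric.cauchySeq_iff']
    intro ε hε
    obtain ⟨N, hN⟩ := (hu.eventually (gt_mem_nhds (by positivity : 0 < ε * R ^ n))).exists
    refine ⟨N, fun M hM => ?_⟩
    obtain ⟨k, rfl⟩ := Nat.exists_eq_add_of_le hM
    have := (hd N k n).trans_lt hN
    rw [map_sub] at this
    rw [dist_eq_norm]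
    exact lt_of_mul_lt_mul_right this (pow_pos hR n).le
  have ht : ∀ n, Tendsto (fun N => PowerSeries.coeff n (f N)) atTop
      (𝓝 (PowerSeries.coeff n (CarlitzMZ.coeffLim f))) := fun n => by
    rw [CarlitzMZ.coeffLim, PowerSeries.coeff_mk]
    exact (hc n).tendsto_limUnder
  refine ⟨fun N n => ?_, ht⟩
  have h1 := (((ht n).sub_const (PowerSeries.coeff n (f N))).norm).mul_const (R ^ n)
  rw [map_sub]
  refine le_of_tendsto h1 (eventually_atTop.2 ⟨N, fun M hM => ?_⟩)
  obtain ⟨k, rfl⟩ := Nat.exists_eq_add_of_le hM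
  rw [← map_sub]
  exact hd N k n

/-- The limit of the iterates of a twisted affine operator that contracts at `f₀`. -/
noncomputable def twistedFixedPoint (σ : K →+* K) (h p f₀ : PowerSeries K) : PowerSeries K :=
  coeffLim fun N => (twistedAffine σ h p)^[N] f₀

/-- The operator is not a global contraction: differences satisfy `T f - T g = p (f - g)⁽¹⁾`, so a
distance `B` becomes at most `A B^q`. Starting from a first step of size `D`, this is contraction by
the factor `A D^(q-1)`. -/
theorem twistedFixedPoint_spec (hσ : ∀ x, ‖σ x‖ = ‖x‖ ^ q) (hq : 1 < q)
    {h p f₀ : PowerSeries K} {R A D : ℝ} (hR : 1 ≤ R) (hA : GaussBound R A p)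
    (hD : GaussBound R D (twistedAffine σ h p f₀ - f₀)) (hAD : A * D ^ (q - 1) < 1) :
    twistedAffine σ h p (twistedFixedPoint σ h p f₀) = twistedFixedPoint σ h p f₀ ∧
    (∀ N, GaussBound R (D * (A * D ^ (q - 1)) ^ N)
      (twistedFixedPoint σ h p f₀ - (twistedAffine σ h p)^[N] f₀)) ∧
    ∀ n, Tendsto (fun N => PowerSeries.coeff n ((twistedAffine σ h p)^[N] f₀)) atTop
        (𝓝 (PowerSeries.coeff n (twistedFixedPoint σ h p f₀))) := by
  have hR0 : 0 < R := by positivity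
  have hD0 := hD.nonneg
  have hA0 := hA.nonneg
  set c := A * D ^ (q - 1) with hc
  have hc0 : 0 ≤ c := by positivity
  set T := twistedAffine σ h p with hT
  have hTsub : ∀ {f g : PowerSeries K} {B : ℝ}, GaussBound R B (f - g) →
      GaussBound R (A * B ^ q) (T f - T g) := by
    intro f g B hB
    have : T f - T g = p * PowerSeries.map σ (f - g) := by
      simp only [hT, twistedAffine, map_sub]; ring
    rw [this]
    exact hA.mul hR0.le (hB.map_same hσ (by omega) hR)
  have hstep : ∀ {N : ℕ}, A * (D * c ^ N) ^ q ≤ D * c ^ (N + 1) := by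
    intro N
    have h1 : D ^ q = D ^ (q - 1) * D := by rw [← pow_succ, Nat.sub_add_cancel hq.le]
    rw [mul_pow, h1, ← pow_mul]
    calc A * (D ^ (q - 1) * D * c ^ (N * q)) = D * (c * c ^ (N * q)) := by rw [hc]; ring
      _ ≤ D * c ^ (N + 1) := by
        rw [← pow_succ']
        gcongr D * ?_
        exact pow_le_pow_of_le_one hc0 hAD.le
          (Nat.succ_le_succ (Nat.le_mul_of_pos_right _ (by omega)))
  have hdiff : ∀ N, GaussBound R (D * c ^ N) (T^[N + 1] f₀ - T^[N] f₀) := by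
    intro N
    induction N with
    | zero => simpa using hD
    | succ N ih =>
      rw [Function.iterate_succ_apply', Function.iterate_succ_apply' T N]
      rw [Function.iterate_succ_apply'] at ih
      exact (hTsub ih).mono hstep
  have hanti : Antitone fun N => D * c ^ N := fun a b hab =>
    mul_le_mul_of_nonneg_left (pow_le_pow_of_le_one hc0 hAD.le hab) hD0
  have htend : Tendsto (fun N => D * c ^ N) atTop (𝓝 0) := by
    simpa using (tendsto_pow_atTop_nhds_zero_of_lt_one hc0 hAD).const_mul D
  obtain ⟨h1, h2⟩ := GaussBound.coeffLim (f := fun N => T^[N] f₀) hR0 hanti htend hdiff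
  refine ⟨?_, h1, h2⟩
  rw [← sub_eq_zero]
  refine GaussBound.eq_zero hR0 (htend.comp (tendsto_add_atTop_nat 1)) fun N => ?_
  -- Both the limit and its image under `T` are within `D c^(N+1)` of the iterate of order `N + 1`.
  rw [← sub_sub_sub_cancel_right _ _ (T^[N + 1] f₀)]
  refine GaussBound.sub hR0.le ?_ (h1 (N + 1))
  rw [Function.iterate_succ_apply']
  exact (hTsub (h1 N)).mono hstep

end Gauss

/-! ### Power series with coefficients in a subring -/

section CoeffsIn

variable {K : Type*} [Field K] {S : Subring K} {f g : PowerSeries K}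

/-- All coefficients of `f` lie in `S`. -/
def CoeffsIn (S : Subring K) (f : PowerSeries K) : Prop := ∀ n, PowerSeries.coeff n f ∈ S

theorem CoeffsIn.C {a : K} (ha : a ∈ S) : CoeffsIn S (PowerSeries.C a) := fun n => by
  rw [PowerSeries.coeff_C]
  split_ifs
  exacts [ha, S.zero_mem]

theorem CoeffsIn.X : CoeffsIn S (PowerSeries.X : PowerSeries K) := fun n => by
  rw [PowerSeries.coeff_X]
  split_ifs
  exacts [S.one_mem, S.zero_mem]

theorem CoeffsIn.zero : CoeffsIn S (0 : PowerSeries K) := fun n => by simp [S.zero_mem]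

theorem CoeffsIn.one : CoeffsIn S (1 : PowerSeries K) := by simpa using CoeffsIn.C S.one_mem

theorem CoeffsIn.add (hf : CoeffsIn S f) (hg : CoeffsIn S g) : CoeffsIn S (f + g) := fun n => by
  rw [map_add]; exact S.add_mem (hf n) (hg n)

theorem CoeffsIn.sub (hf : CoeffsIn S f) (hg : CoeffsIn S g) : CoeffsIn S (f - g) := fun n => by
  rw [map_sub]; exact S.sub_mem (hf n) (hg n)

theorem CoeffsIn.mul (hf : CoeffsIn S f) (hg : CoeffsIn S g) : CoeffsIn S (f * g) := fun n => by
  rw [PowerSeries.coeff_mul]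
  exact S.sum_mem fun p _ => S.mul_mem (hf _) (hg _)

theorem CoeffsIn.pow (hf : CoeffsIn S f) (n : ℕ) : CoeffsIn S (f ^ n) := by
  induction n with
  | zero => simpa using CoeffsIn.one
  | succ n ih => rw [pow_succ]; exact ih.mul hf

theorem CoeffsIn.map {σ : K →+* K} (hσ : ∀ x ∈ S, σ x ∈ S) (hf : CoeffsIn S f) :
    CoeffsIn S (PowerSeries.map σ f) := fun n => by
  rw [PowerSeries.coeff_map]; exact hσ _ (hf n)

end CoeffsIn

/-! ### Coefficients of twisted fixed points and of their approximations -/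

section FixedPointCoeffs

variable {K : Type*} [NormedField K] {S : Subring K} {σ : K →+* K} {h p f f₀ : PowerSeries K}

theorem CoeffsIn.twistedAffine_iterate (hσ : ∀ x ∈ S, σ x ∈ S) (hh : CoeffsIn S h)
    (hp : CoeffsIn S p) (hf : CoeffsIn S f₀) (N : ℕ) :
    CoeffsIn S ((twistedAffine σ h p)^[N] f₀) := by
  induction N with
  | zero => simpa using hf
  | succ N ih =>
    rw [Function.iterate_succ_apply']
    exact hh.add (hp.mul (ih.map hσ))

/-- The coefficients of a solution of `f = h + p f⁽¹⁾` are solutions of equations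
`x = β + α σ(x)`. -/
theorem CoeffsIn.of_twistedAffine_eq (hσ : ∀ x ∈ S, σ x ∈ S)
    (hS : ∀ α ∈ S, ∀ β ∈ S, ∀ x, x = β + α * σ x → x ∈ S) (hh : CoeffsIn S h)
    (hp : CoeffsIn S p) (hf : twistedAffine σ h p f = f) : CoeffsIn S f := by
  intro n
  induction n using Nat.strong_induction_on with
  | _ n ih =>
    -- In the coefficient of order `n` of `p f⁽¹⁾`, only the pair `(0, n)` involves the unknown
    -- coefficient; all others are covered by induction.
    refine hS (PowerSeries.coeff 0 p) (hp 0) (PowerSeries.coeff n h +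
      ∑ i ∈ (Finset.HasAntidiagonal.antidiagonal n).erase (0, n),
        PowerSeries.coeff i.1 p * σ (PowerSeries.coeff i.2 f))
      (S.add_mem (hh n) (S.sum_mem fun i hi => S.mul_mem (hp _) (hσ _ (ih _ ?_)))) _ ?_
    · rw [Finset.mem_erase, Finset.HasAntidiagonal.mem_antidiagonal] at hi
      obtain ⟨i, j⟩ := i
      simp only [ne_eq, Prod.mk.injEq] at hi ⊢
      omega
    · conv_lhs => rw [← hf]
      rw [twistedAffine, map_add, PowerSeries.coeff_mul,
        ← Finset.add_sum_erase _ _ (by simp : (0, n) ∈ Finset.HasAntidiagonal.antidiagonal n)]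
      simp only [PowerSeries.coeff_map]
      ring

end FixedPointCoeffs

/-! ### The field `ℂ_∞` -/

section CInfFacts

variable (F : Type*) [Field F] [Fintype F]

instance CInf.instIsUltrametricDist : IsUltrametricDist (CInf F) :=
  IsUltrametricDist.of_normedAlgebra (KInf F)

instance CInf.instIsScalarTowerKInf : IsScalarTower (RatFunc F) (KInf F) (CInf F) :=
  IsScalarTower.of_algebraMap_eq fun x => by
    rw [IsScalarTower.algebraMap_apply (RatFunc F) (KInfBar F) (CInf F),
      IsScalarTower.algebraMap_apply (RatFunc F) (KInf F) (KInfBar F)]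
    rfl

theorem norm_frobHom (x : CInf F) : ‖frobHom F x‖ = ‖x‖ ^ Fintype.card F := by
  rw [frobHom_apply, norm_pow]

theorem continuous_frobHom : Continuous (frobHom F) := by
  change Continuous fun x : CInf F => x ^ Fintype.card F
  fun_prop

variable {F}

/-- An element integral over `k_∞` is integral over its algebraic closure, where its minimal
polynomial is linear. Completing thus adds no new algebraic elements. -/
theorem mem_range_of_isIntegral {x : CInf F} (hx : IsIntegral (KInf F) x) :
    x ∈ Set.range (algebraMap (KInfBar F) (CInf F)) := by
  have h : IsIntegral (KInfBar F) x := hx.tower_top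
  exact minpoly.mem_range_of_degree_eq_one _ _
    (IsAlgClosed.degree_eq_one_of_irreducible _ (minpoly.irreducible h))

theorem mem_kBar_iff {x : CInf F} : x ∈ kBar F ↔ IsAlgebraic (RatFunc F) x := by
  constructor
  · rintro ⟨y, hy, rfl⟩
    exact (isAlgebraic_algHom_iff (IsScalarTower.toAlgHom (RatFunc F) (KInfBar F) (CInf F))
      (algebraMap (KInfBar F) (CInf F)).injective).2 (mem_algebraicClosure_iff.1 hy)
  · intro hx
    have hi : IsIntegral (KInf F) x := hx.isIntegral.tower_top
    obtain ⟨y, rfl⟩ := mem_range_of_isIntegral hi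
    refine ⟨y, ?_, rfl⟩
    exact mem_algebraicClosure_iff.2
      ((isAlgebraic_algHom_iff (IsScalarTower.toAlgHom (RatFunc F) (KInfBar F) (CInf F))
        (algebraMap (KInfBar F) (CInf F)).injective).1 hx)

theorem isIntegral_of_mem_kBar {x : CInf F} (hx : x ∈ kBar F) : IsIntegral (KInf F) x :=
  (mem_kBar_iff.1 hx).isIntegral.tower_top

theorem theta_mem_kBar : theta F ∈ kBar F := (kBar F).algebraMap_mem _

theorem mem_kBar_of_pow_mem {x : CInf F} {n : ℕ} (hn : 0 < n) (hx : x ^ n ∈ kBar F) :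
    x ∈ kBar F :=
  mem_kBar_iff.2 ((mem_kBar_iff.1 hx).of_pow hn)

open Polynomial in
theorem mem_kBar_of_eq_add_mul_pow {n : ℕ} (hn : 1 < n) {α β x : CInf F} (hα : α ∈ kBar F)
    (hβ : β ∈ kBar F) (hx : x = β + α * x ^ n) : x ∈ kBar F := by
  have hx' : IsAlgebraic (kBar F) x := by
    -- Since `n > 1`, the coefficient of `X` is `-1`, so the polynomial is nonzero even when `α =
    -- 0`.
    refine ⟨C ⟨β, hβ⟩ + C ⟨α, hα⟩ * X ^ n - X, fun h => ?_, ?_⟩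
    · have := congrArg (fun p => coeff p 1) h
      simp [coeff_X_pow, hn.ne] at this
    · simp only [map_add, map_sub, map_mul, map_pow, aeval_X, aeval_C]
      change β + α * x ^ n - x = 0
      rw [← hx, sub_self]
  have : Algebra.IsAlgebraic (RatFunc F) (kBar F) :=
    ⟨fun y => (isAlgebraic_algHom_iff (kBar F).val Subtype.val_injective).1
      (mem_kBar_iff.1 y.2)⟩
  exact mem_kBar_iff.2 (hx'.restrictScalars (RatFunc F))

theorem isClosed_of_finiteDimensional (K : IntermediateField (KInf F) (CInf F))
    [FiniteDimensional (KInf F) K] : IsClosed (K : Set (CInf F)) := by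
  have : FiniteDimensional (KInf F) K.toSubalgebra.toSubmodule :=
    inferInstanceAs (FiniteDimensional (KInf F) K)
  exact K.toSubalgebra.toSubmodule.closed_of_finiteDimensional

theorem twist_neg_one_map (f : PowerSeries (CInf F)) :
    twist (-1) (PowerSeries.map (frobHom F) f) = f := by
  ext n
  rw [twist, PowerSeries.coeff_map, PowerSeries.coeff_map, zpow_neg_one]
  exact (frob F).symm_apply_apply (PowerSeries.coeff n f)

theorem theta_ne_zero : theta F ≠ 0 := by
  rw [← norm_pos_iff, norm_theta]
  exact_mod_cast Fintype.card_pos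

theorem theta_pow_ne_theta {n : ℕ} (hn : n ≠ 1) : theta F ^ n ≠ theta F := fun h => by
  have := congrArg norm h
  rw [norm_pow, norm_theta] at this
  have h2 : Fintype.card F ^ n = Fintype.card F ^ 1 := by rw [pow_one]; exact_mod_cast this
  exact hn (Nat.pow_right_injective Fintype.one_lt_card h2)

theorem ell_ne_zero (i : ℕ) : ell F i ≠ 0 :=
  Finset.prod_ne_zero_iff.2 fun j hj => by
    rw [sub_ne_zero]
    refine (theta_pow_ne_theta (one_lt_pow₀ Fintype.one_lt_card ?_).ne').symm
    have := (Finset.mem_Icc.1 hj).1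
    omega

end CInfFacts

/-! ### Evaluation -/

section Eval

variable {F : Type*} [Field F] [Fintype F] {f g : PowerSeries (CInf F)}

theorem evalAt_C (a x : CInf F) : evalAt (PowerSeries.C a) x = a := by
  rw [evalAt, tsum_eq_single 0]
  · simp
  · intro n hn
    simp [PowerSeries.coeff_C, hn]

theorem evalAt_X (x : CInf F) : evalAt PowerSeries.X x = x := by
  rw [evalAt, tsum_eq_single 1]
  · simp
  · intro n hn
    simp [PowerSeries.coeff_X, hn]

theorem evalAt_one (x : CInf F) : evalAt 1 x = 1 := by simpa using evalAt_C 1 x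

theorem GaussFinite.evalAt_add (hf : GaussFinite f) (hg : GaussFinite g) (x : CInf F) :
    evalAt (f + g) x = evalAt f x + evalAt g x := by
  rw [evalAt, evalAt, evalAt, ← (hf.summable_norm x).of_norm.tsum_add
    (hg.summable_norm x).of_norm]
  simp only [map_add, add_mul]

theorem GaussFinite.evalAt_sub (hf : GaussFinite f) (hg : GaussFinite g) (x : CInf F) :
    evalAt (f - g) x = evalAt f x - evalAt g x := by
  rw [evalAt, evalAt, evalAt, ← (hf.summable_norm x).of_norm.tsum_sub
    (hg.summable_norm x).of_norm]
  simp only [map_sub, sub_mul]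

theorem GaussFinite.evalAt_mul (hf : GaussFinite f) (hg : GaussFinite g) (x : CInf F) :
    evalAt (f * g) x = evalAt f x * evalAt g x := by
  rw [evalAt, evalAt, evalAt, tsum_mul_tsum_eq_tsum_sum_antidiagonal_of_summable_norm
    (hf.summable_norm x) (hg.summable_norm x)]
  refine tsum_congr fun n => ?_
  rw [PowerSeries.coeff_mul, Finset.sum_mul]
  refine Finset.sum_congr rfl fun p hp => ?_
  rw [← Finset.HasAntidiagonal.mem_antidiagonal.1 hp, pow_add, mul_mul_mul_comm]

theorem GaussFinite.evalAt_pow (hf : GaussFinite f) (n : ℕ) (x : CInf F) :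
    evalAt (f ^ n) x = evalAt f x ^ n := by
  induction n with
  | zero => rw [pow_zero, pow_zero, evalAt_one]
  | succ n ih => rw [pow_succ, pow_succ, (hf.pow n).evalAt_mul hf, ih]

/-- Frobenius is a continuous ring homomorphism, so it passes through the sum. This links the values
at `θ^(q^N)` and `θ^(q^(N+1))`. -/
theorem GaussFinite.evalAt_map (hf : GaussFinite f) (x : CInf F) :
    evalAt (PowerSeries.map (frobHom F) f) (x ^ Fintype.card F) =
      evalAt f x ^ Fintype.card F := by
  have := (hf.summable_norm x).of_norm.map_tsum (frobHom F) (continuous_frobHom F)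
  rw [evalAt, evalAt, ← frobHom_apply F (∑' n, _), this]
  refine tsum_congr fun n => ?_
  rw [PowerSeries.coeff_map, map_mul, map_pow, frobHom_apply F x]

theorem GaussBound.norm_evalAt_le {R B : ℝ} (hf : GaussBound R B f) {x : CInf F} (hx : ‖x‖ ≤ R) :
    ‖evalAt f x‖ ≤ B :=
  IsUltrametricDist.norm_tsum_le_of_forall_le_of_nonneg hf.nonneg fun n => by
    rw [norm_mul, norm_pow]
    exact hf.mono_radius (norm_nonneg x) hx n

theorem GaussFinite.map_frobHom (hf : GaussFinite f) :
    GaussFinite (PowerSeries.map (frobHom F) f) :=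
  hf.map (norm_frobHom F) Fintype.card_ne_zero

theorem GaussFinite.isEntire (hf : GaussFinite f) (hk : CoeffsIn (kBar F).toSubring f)
    {K : IntermediateField (KInf F) (CInf F)} [FiniteDimensional (KInf F) K]
    (hK : CoeffsIn K.toSubring f) : IsEntire f where
  coeff_mem := hk
  tendsto := hf.tendsto_rpow
  finite := by
    have hle : IntermediateField.adjoin (KInf F)
        (Set.range fun n => PowerSeries.coeff n f) ≤ K :=
      IntermediateField.adjoin_le_iff.2 (by rintro _ ⟨n, rfl⟩; exact hK n)
    exact Module.Finite.of_injective (IntermediateField.inclusion hle).toLinearMap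
      (IntermediateField.inclusion hle).injective

end Eval

/-! ### Nested sums over decreasing indices -/

section NestedSums

/-- The index set `i₁ > ⋯ > i_j ≥ m`. -/
abbrev DecIndexGE (j m : ℕ) := {i : Fin j → ℕ // StrictAnti i ∧ ∀ k, m ≤ i k}

/-- Splitting off the last index `i_{j+1} = m + a`. -/
def DecIndexGE.snocEquiv (j m : ℕ) :
    (Σ a : ℕ, DecIndexGE j (m + a + 1)) ≃ DecIndexGE (j + 1) m where
  toFun p := ⟨Fin.snoc p.2.1 (m + p.1), by
    obtain ⟨a, i, h1, h2⟩ := p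
    constructor
    · intro k l hkl
      induction l using Fin.lastCases with
      | last =>
        obtain ⟨k, rfl⟩ := Fin.exists_castSucc_eq.2 hkl.ne
        simpa using h2 k
      | cast l =>
        obtain ⟨k, rfl⟩ := Fin.exists_castSucc_eq.2 (hkl.trans (Fin.castSucc_lt_last l)).ne
        simpa using h1 (Fin.castSucc_lt_castSucc_iff.1 hkl)
    · intro k
      induction k using Fin.lastCases with
      | last => simp
      | cast k => have := h2 k; simp; omega⟩
  invFun i := ⟨i.1 (Fin.last j) - m, fun k => i.1 k.castSucc,
    fun k l hkl => i.2.1 (Fin.castSucc_lt_castSucc_iff.2 hkl), fun k => by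
      have h1 := i.2.2 (Fin.last j)
      have h2 := i.2.1 (Fin.castSucc_lt_last k)
      change m + (i.1 (Fin.last j) - m) + 1 ≤ i.1 k.castSucc
      omega⟩
  left_inv p := by
    obtain ⟨a, i, h1, h2⟩ := p
    refine Sigma.subtype_ext ?_ ?_
    · simp
    · simp
  right_inv i := by
    obtain ⟨i, h1, h2⟩ := i
    ext k
    have := h2 (Fin.last j)
    induction k using Fin.lastCases with
    | last => simp; omega
    | cast k => simp

variable {K : Type*} [NormedField K] [CompleteSpace K]

/-- If `A_{j+1}(m) = c_j(m) A_j(m+1) + A_{j+1}(m+1)`, `A_0 = 1` and `A_{j+1}(m) → 0`, then `A_j(m)`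
is the nested sum of the products of the `c_k`. -/
theorem tsum_decIndexGE_eq {r : ℕ} {c A : ℕ → ℕ → K} (h0 : ∀ m, A 0 m = 1)
    (hA : ∀ j < r, ∀ m, A (j + 1) m = c j m * A j (m + 1) + A (j + 1) (m + 1))
    (ht : ∀ j < r, Tendsto (A (j + 1)) atTop (𝓝 0)) (j : ℕ) (hj : j ≤ r) (m : ℕ)
    (hs : Summable fun i : DecIndexGE j m => ∏ k : Fin j, c k (i.1 k)) :
    ∑' i : DecIndexGE j m, ∏ k : Fin j, c k (i.1 k) = A j m := by
  induction j generalizing m with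
  | zero =>
    have : Unique (DecIndexGE 0 m) :=
      ⟨⟨⟨Fin.elim0, fun k => k.elim0, fun k => k.elim0⟩⟩, fun i => Subtype.ext (Subsingleton.elim _ _)⟩
    rw [tsum_eq_single default fun i hi => (hi (Subsingleton.elim _ _)).elim]
    simp [h0]
  | succ j ih =>
    have hterm : ∀ p : Σ a : ℕ, DecIndexGE j (m + a + 1),
        ∏ k : Fin (j + 1), c k ((DecIndexGE.snocEquiv j m p).1 k) = c j (m + p.1) * ∏ k : Fin j, c k (p.2.1 k) := by
      intro p
      rw [Fin.prod_univ_castSucc, mul_comm]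
      simp [DecIndexGE.snocEquiv]
    rw [← (DecIndexGE.snocEquiv j m).summable_iff] at hs
    rw [← (DecIndexGE.snocEquiv j m).tsum_eq]
    simp only [Function.comp_def, hterm] at hs ⊢
    have hfib : ∀ a, ∑' i : DecIndexGE j (m + a + 1), c j (m + a) * ∏ k : Fin j, c k (i.1 k) =
        c j (m + a) * A j (m + a + 1) := by
      intro a
      rw [tsum_mul_left]
      -- Summability of the inner family follows from that of the whole only if the factor is
      -- nonzero; otherwise both sides vanish.
      by_cases hc : c j (m + a) = 0
      · rw [hc, zero_mul, zero_mul]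
      · rw [ih (by omega) _ ((summable_mul_left_iff hc).1 (hs.sigma_factor a))]
    have hsum := hs.sigma
    rw [hs.tsum_sigma]
    simp only [hfib] at hsum ⊢
    refine tendsto_nhds_unique hsum.hasSum.tendsto_sum_nat ?_
    -- The recursion makes the partial sums telescope, and the remainder tends to `0`.
    have hpart : ∀ n, ∑ a ∈ Finset.range n, c j (m + a) * A j (m + a + 1) =
        A (j + 1) m - A (j + 1) (m + n) := by
      intro n
      induction n with
      | zero => simp
      | succ n ihn =>
        rw [Finset.sum_range_succ, ihn, hA j (by omega) (m + n), ← add_assoc]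
        ring
    simp only [hpart]
    have := ((ht j (by omega)).comp (tendsto_add_atTop_nat m)).const_sub (A (j + 1) m)
    simpa [Function.comp_def, add_comm m] using this

end NestedSums

/-! ### The power series `Ω` -/

section OmegaSeries

variable {F : Type*} [Field F] [Fintype F]

/-- The power series expansion of `Ω`, as a solution of `Ω = (t - θ^q) Ω⁽¹⁾`. -/
noncomputable def omegaSeries (θ' : CInf F) : PowerSeries (CInf F) :=
  twistedFixedPoint (frobHom F) 0
    (PowerSeries.X - PowerSeries.C (theta F ^ Fintype.card F))
    (PowerSeries.C (θ' ^ Fintype.card F)⁻¹)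

theorem gaussFinite_X_sub_C (a : CInf F) :
    GaussFinite (PowerSeries.X - PowerSeries.C a) :=
  GaussFinite.X.sub (GaussFinite.C a)

theorem evalAt_X_sub_C (a x : CInf F) : evalAt (PowerSeries.X - PowerSeries.C a) x = x - a := by
  rw [GaussFinite.X.evalAt_sub (GaussFinite.C a), evalAt_X, evalAt_C]

theorem frobHom_mem_kBar {x : CInf F} (hx : x ∈ (kBar F).toSubring) :
    frobHom F x ∈ (kBar F).toSubring := by
  rw [frobHom_apply]; exact pow_mem hx _

theorem frobHom_mem (K : IntermediateField (KInf F) (CInf F)) {x : CInf F}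
    (hx : x ∈ K.toSubring) : frobHom F x ∈ K.toSubring := by
  rw [frobHom_apply]; exact pow_mem hx _

theorem one_lt_card_real : (1 : ℝ) < Fintype.card F := by
  exact_mod_cast Fintype.one_lt_card

theorem theta_mem (K : IntermediateField (KInf F) (CInf F)) : theta F ∈ K := by
  rw [theta, IsScalarTower.algebraMap_apply (RatFunc F) (KInf F) (CInf F)]
  exact K.algebraMap_mem _

theorem iterate_map_X_sub_C (a : CInf F) (i : ℕ) :
    (PowerSeries.map (frobHom F))^[i] (PowerSeries.X - PowerSeries.C a) =
      PowerSeries.X - PowerSeries.C (a ^ Fintype.card F ^ i) := by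
  induction i with
  | zero => simp
  | succ i ih =>
    rw [Function.iterate_succ_apply', ih, map_sub, PowerSeries.map_X, PowerSeries.map_C,
      frobHom_apply, ← pow_mul, ← pow_succ]

variable {θ' : CInf F} (hθ' : θ' ^ (Fintype.card F - 1) = -theta F)
include hθ'

theorem thetaRoot_ne_zero : θ' ≠ 0 := by
  rintro rfl
  have : Fintype.card F - 1 ≠ 0 := by have := Fintype.one_lt_card (α := F); omega
  rw [zero_pow this, zero_eq_neg] at hθ'
  exact theta_ne_zero hθ'

theorem thetaRoot_mem_kBar : θ' ∈ kBar F :=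
  mem_kBar_of_pow_mem (Nat.sub_pos_of_lt Fintype.one_lt_card)
    (hθ' ▸ neg_mem theta_mem_kBar)

theorem inv_thetaRoot_pow_card :
    ((θ' ^ Fintype.card F)⁻¹) ^ Fintype.card F =
      -((theta F ^ Fintype.card F)⁻¹ * (θ' ^ Fintype.card F)⁻¹) := by
  -- Additivity of Frobenius settles the sign in every characteristic.
  have h1 : (-theta F) ^ Fintype.card F = -theta F ^ Fintype.card F := by
    rw [← frobHom_apply, map_neg, frobHom_apply]
  have h2 : (θ' ^ Fintype.card F) ^ Fintype.card F =
      -(theta F ^ Fintype.card F * θ' ^ Fintype.card F) := by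
    rw [← neg_mul, ← h1, ← hθ', ← mul_pow, ← pow_succ, Nat.sub_add_cancel Fintype.card_pos]
  rw [inv_pow, h2, ← mul_inv, inv_neg]

theorem norm_inv_thetaRoot_pow :
    ‖(θ' ^ Fintype.card F)⁻¹‖ ^ (Fintype.card F - 1) =
      ((Fintype.card F : ℝ) ^ Fintype.card F)⁻¹ := by
  rw [norm_inv, norm_pow, inv_pow, pow_right_comm, ← norm_pow, hθ', norm_neg, norm_theta]

theorem norm_inv_thetaRoot_pow_card :
    ‖(θ' ^ Fintype.card F)⁻¹‖ ^ Fintype.card F =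
      ‖(θ' ^ Fintype.card F)⁻¹‖ * ((Fintype.card F : ℝ) ^ Fintype.card F)⁻¹ := by
  rw [← norm_inv_thetaRoot_pow hθ', ← pow_succ', Nat.sub_add_cancel Fintype.card_pos]

theorem omegaSeries_spec :
    twistedAffine (frobHom F) 0 (PowerSeries.X - PowerSeries.C (theta F ^ Fintype.card F))
      (omegaSeries θ') = omegaSeries θ' ∧
    (∃ D c : ℝ, 0 ≤ c ∧ c < 1 ∧ D ≤ ‖(θ' ^ Fintype.card F)⁻¹‖ ∧
      ∀ N, GaussBound (Fintype.card F) (D * c ^ N) (omegaSeries θ' -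
        (twistedAffine (frobHom F) 0
          (PowerSeries.X - PowerSeries.C (theta F ^ Fintype.card F)))^[N]
            (PowerSeries.C (θ' ^ Fintype.card F)⁻¹))) ∧
    ∀ n, Tendsto (fun N => PowerSeries.coeff n ((twistedAffine (frobHom F) 0
          (PowerSeries.X - PowerSeries.C (theta F ^ Fintype.card F)))^[N]
            (PowerSeries.C (θ' ^ Fintype.card F)⁻¹))) atTop
      (𝓝 (PowerSeries.coeff n (omegaSeries θ'))) := by
  have hq := Fintype.one_lt_card (α := F)
  have hq1 := one_lt_card_real (F := F)
  have hq0 : (0 : ℝ) < Fintype.card F := by positivity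
  set a := (θ' ^ Fintype.card F)⁻¹ with ha
  set p : PowerSeries (CInf F) := PowerSeries.X - PowerSeries.C (theta F ^ Fintype.card F) with hp
  have hlt : (Fintype.card F : ℝ) / (Fintype.card F : ℝ) ^ Fintype.card F < 1 := by
    rw [div_lt_one (by positivity)]
    exact lt_self_pow₀ hq1 hq
  have hA : GaussBound (Fintype.card F : ℝ) ((Fintype.card F : ℝ) ^ Fintype.card F) p := by
    refine GaussBound.sub hq0.le
      ((GaussBound.X hq0.le).mono (le_self_pow₀ hq1.le (by omega))) ?_
    refine (GaussBound.C _).mono ?_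
    rw [norm_pow, norm_theta]
  -- Because `θ^q a^q = -a`, the constant terms cancel and the first correction is `a^q t`, of norm
  -- `‖a‖ q^(1-q)` on the disc of radius `q`.
  have hD : GaussBound (Fintype.card F : ℝ)
      (‖a‖ * ((Fintype.card F : ℝ) / (Fintype.card F : ℝ) ^ Fintype.card F))
      (twistedAffine (frobHom F) 0 p (PowerSeries.C a) - PowerSeries.C a) := by
    have h1 : theta F ^ Fintype.card F * a ^ Fintype.card F = -a := by
      rw [ha, inv_thetaRoot_pow_card hθ', mul_neg,
        mul_inv_cancel_left₀ (pow_ne_zero _ theta_ne_zero)]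
    have h2 : twistedAffine (frobHom F) 0 p (PowerSeries.C a) - PowerSeries.C a =
        PowerSeries.C (a ^ Fintype.card F) * PowerSeries.X := by
      rw [twistedAffine, PowerSeries.map_C, frobHom_apply, zero_add, hp, sub_mul, ← map_mul, h1,
        map_neg]
      ring
    rw [h2]
    refine ((GaussBound.C (a ^ Fintype.card F)).mul hq0.le (GaussBound.X hq0.le)).mono
      (le_of_eq ?_)
    rw [norm_pow, norm_inv_thetaRoot_pow_card hθ', ← ha]
    ring
  have hAD : (Fintype.card F : ℝ) ^ Fintype.card F * (‖a‖ * ((Fintype.card F : ℝ) /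
      (Fintype.card F : ℝ) ^ Fintype.card F)) ^ (Fintype.card F - 1) < 1 := by
    rw [mul_pow, norm_inv_thetaRoot_pow hθ', mul_inv_cancel_left₀ (by positivity)]
    exact pow_lt_one₀ (by positivity) hlt (by omega)
  obtain ⟨h1, h2, h3⟩ := twistedFixedPoint_spec (norm_frobHom F) hq hq1.le hA hD hAD
  exact ⟨h1, ⟨_, _, by positivity, hAD, mul_le_of_le_one_right (norm_nonneg _) hlt.le, h2⟩, h3⟩

theorem omegaSeries_eq :
    (PowerSeries.X - PowerSeries.C (theta F ^ Fintype.card F)) *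
      PowerSeries.map (frobHom F) (omegaSeries θ') = omegaSeries θ' := by
  conv_rhs => rw [← (omegaSeries_spec hθ').1]
  rw [twistedAffine, zero_add]

theorem gaussBound_omegaSeries :
    GaussBound (Fintype.card F) ‖(θ' ^ Fintype.card F)⁻¹‖ (omegaSeries θ') := by
  obtain ⟨-, ⟨D, c, -, -, hD, h⟩, -⟩ := omegaSeries_spec hθ'
  have h0 := h 0
  rw [pow_zero, mul_one, Function.iterate_zero, id] at h0
  rw [← sub_add_cancel (omegaSeries θ') (PowerSeries.C (θ' ^ Fintype.card F)⁻¹)]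
  exact (h0.mono hD).add (Nat.cast_nonneg _) (GaussBound.C _)

theorem gaussFinite_omegaSeries : GaussFinite (omegaSeries θ') :=
  GaussFinite.of_twistedAffine_eq (norm_frobHom F) Fintype.one_lt_card
    (by simpa using GaussFinite.C (0 : CInf F))
    (gaussFinite_X_sub_C _) (omegaSeries_spec hθ').1 one_lt_card_real (gaussBound_omegaSeries hθ')

theorem coeffsIn_kBar_omegaSeries : CoeffsIn (kBar F).toSubring (omegaSeries θ') :=
  CoeffsIn.of_twistedAffine_eq (fun _ => frobHom_mem_kBar)
    (fun _ hα _ hβ _ hx => mem_kBar_of_eq_add_mul_pow Fintype.one_lt_card hα hβ hx)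
    CoeffsIn.zero (CoeffsIn.X.sub (CoeffsIn.C (pow_mem (theta_mem_kBar (F := F)) _)))
    (omegaSeries_spec hθ').1

theorem coeffsIn_omegaSeries (K : IntermediateField (KInf F) (CInf F))
    [FiniteDimensional (KInf F) K] (hK : θ' ∈ K) : CoeffsIn K.toSubring (omegaSeries θ') := by
  intro n
  refine (isClosed_of_finiteDimensional K).mem_of_tendsto ((omegaSeries_spec hθ').2.2 n)
    (Eventually.of_forall fun N => ?_)
  exact CoeffsIn.twistedAffine_iterate (S := K.toSubring) (fun _ => frobHom_mem K) CoeffsIn.zero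
    (CoeffsIn.X.sub (CoeffsIn.C (pow_mem (theta_mem K) _)))
    (CoeffsIn.C (S := K.toSubring) (K.inv_mem (pow_mem hK _))) N n

/-- Twisting turns each factor `1 - t/θ^(q^i)` into the next one, and `(t - θ^q) a^q = a (1 -
t/θ^q)` supplies the missing first factor. -/
theorem twistedAffine_iterate_eq_prod (N : ℕ) :
    (twistedAffine (frobHom F) 0 (PowerSeries.X - PowerSeries.C (theta F ^ Fintype.card F)))^[N]
      (PowerSeries.C (θ' ^ Fintype.card F)⁻¹) = PowerSeries.C (θ' ^ Fintype.card F)⁻¹ *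
        ∏ i ∈ Finset.range N, (1 - PowerSeries.C (theta F ^ Fintype.card F ^ (i + 1))⁻¹ *
          PowerSeries.X) := by
  have h1 : theta F ^ Fintype.card F * ((θ' ^ Fintype.card F)⁻¹) ^ Fintype.card F =
      -(θ' ^ Fintype.card F)⁻¹ := by
    rw [inv_thetaRoot_pow_card hθ', mul_neg,
      mul_inv_cancel_left₀ (pow_ne_zero _ theta_ne_zero)]
  have h2 := inv_thetaRoot_pow_card hθ'
  generalize (θ' ^ Fintype.card F)⁻¹ = a at h1 h2 ⊢
  induction N with
  | zero => simp
  | succ N ih =>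
    rw [Function.iterate_succ_apply', ih, twistedAffine, Finset.prod_range_succ', map_mul, map_prod]
    simp only [map_sub (PowerSeries.map _), map_mul (PowerSeries.map _), map_one,
      PowerSeries.map_C, PowerSeries.map_X, frobHom_apply, inv_pow, ← pow_mul, ← pow_succ]
    rw [sub_mul, zero_add, ← mul_assoc (PowerSeries.C (theta F ^ Fintype.card F)),
      ← map_mul PowerSeries.C, h1, h2, map_neg, map_neg, map_mul PowerSeries.C, zero_add, pow_one]
    ring

/-- The iterates are the partial products of `Ω`, and they converge in Gauss norm on the disc of
radius `q`, which contains `θ`. -/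
theorem evalAt_omegaSeries : evalAt (omegaSeries θ') (theta F) = Omega θ' (theta F) := by
  have hq1 := one_lt_card_real (F := F)
  obtain ⟨-, ⟨D, c, hc0, hc1, -, h⟩, -⟩ := omegaSeries_spec hθ'
  have hfac : ∀ i : ℕ, GaussFinite (1 - PowerSeries.C (theta F ^ Fintype.card F ^ (i + 1))⁻¹ *
      PowerSeries.X) := fun i => GaussFinite.one.sub ((GaussFinite.C _).mul GaussFinite.X)
  have hprod : ∀ N, evalAt (PowerSeries.C (θ' ^ Fintype.card F)⁻¹ *
      ∏ i ∈ Finset.range N, (1 - PowerSeries.C (theta F ^ Fintype.card F ^ (i + 1))⁻¹ *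
        PowerSeries.X)) (theta F) = (θ' ^ Fintype.card F)⁻¹ *
      ∏ i ∈ Finset.range N, (1 - theta F / theta F ^ Fintype.card F ^ (i + 1)) := by
    intro N
    rw [(GaussFinite.C _).evalAt_mul (GaussFinite.prod _ hfac), evalAt_C]
    congr 1
    induction N with
    | zero => simp [evalAt_one]
    | succ N ih =>
      rw [Finset.prod_range_succ, Finset.prod_range_succ,
        (GaussFinite.prod _ hfac).evalAt_mul (hfac N), ih,
        GaussFinite.one.evalAt_sub ((GaussFinite.C _).mul GaussFinite.X),
        (GaussFinite.C _).evalAt_mul GaussFinite.X, evalAt_one, evalAt_C, evalAt_X, div_eq_inv_mul]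
  have hmul : Multipliable fun i : ℕ => 1 - theta F / theta F ^ Fintype.card F ^ (i + 1) := by
    simp only [sub_eq_add_neg]
    refine multipliable_one_add_of_summable (Summable.of_nonneg_of_le (fun _ => norm_nonneg _)
      (fun i => ?_) (summable_geometric_of_lt_one (r := ((Fintype.card F : ℝ))⁻¹)
        (by positivity) (inv_lt_one_of_one_lt₀ hq1)))
    rw [norm_neg, norm_div, norm_pow, norm_theta, inv_pow, div_le_iff₀ (by positivity),
      ← div_eq_inv_mul, le_div_iff₀ (by positivity), ← pow_succ']
    exact pow_le_pow_right₀ hq1.le (Nat.lt_pow_self Fintype.one_lt_card).le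
  have ht1 := (hmul.hasProd.tendsto_prod_nat).const_mul (θ' ^ Fintype.card F)⁻¹
  refine tendsto_nhds_unique ?_ ht1
  rw [tendsto_iff_norm_sub_tendsto_zero]
  refine squeeze_zero (fun _ => norm_nonneg _) (fun N => ?_)
    (by simpa using (tendsto_pow_atTop_nhds_zero_of_lt_one hc0 hc1).const_mul D)
  have hN := h N
  rw [twistedAffine_iterate_eq_prod hθ'] at hN
  rw [norm_sub_rev, ← hprod, ← (gaussFinite_omegaSeries hθ').evalAt_sub
    ((GaussFinite.C _).mul (GaussFinite.prod _ hfac))]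
  exact hN.norm_evalAt_le (norm_theta F).le

theorem evalAt_omegaSeries_theta_pow (N : ℕ) :
    evalAt (omegaSeries θ') (theta F ^ Fintype.card F ^ (N + 1)) = 0 := by
  have hf := gaussFinite_omegaSeries hθ'
  have hx : ∀ x, evalAt (omegaSeries θ') x = (x - theta F ^ Fintype.card F) *
      evalAt (PowerSeries.map (frobHom F) (omegaSeries θ')) x := fun x => by
    conv_lhs => rw [← omegaSeries_eq hθ', (gaussFinite_X_sub_C _).evalAt_mul hf.map_frobHom,
      evalAt_X_sub_C]
  rw [hx]
  induction N with
  | zero => simp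
  | succ N ih =>
    rw [← hx] at ih
    rw [pow_succ _ (N + 1), pow_mul, hf.evalAt_map, ih, zero_pow Fintype.card_ne_zero, mul_zero]

theorem evalAt_iterate_omegaSeries (i : ℕ) :
    evalAt ((PowerSeries.map (frobHom F))^[i] (omegaSeries θ')) (theta F) =
      Omega θ' (theta F) / ell F i := by
  have hf := gaussFinite_omegaSeries hθ'
  rw [eq_div_iff (ell_ne_zero i)]
  induction i with
  | zero => simp [ell, evalAt_omegaSeries hθ']
  | succ i ih =>
    have h1 := congrArg (PowerSeries.map (frobHom F))^[i] (omegaSeries_eq hθ')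
    rw [iterate_map_mul, iterate_map_X_sub_C, ← Function.iterate_succ_apply, ← pow_mul,
      ← pow_succ'] at h1
    rw [← h1, (gaussFinite_X_sub_C _).evalAt_mul
      (hf.map_iterate (norm_frobHom F) Fintype.card_ne_zero _), evalAt_X_sub_C] at ih
    rw [← ih, ell, ell, Finset.prod_Icc_succ_top (by omega)]
    ring

end OmegaSeries

/-! ### The deformation series of Carlitz multiple polylogarithms -/

section Polylog

variable {F : Type*} [Field F] [Fintype F]

/-- The series `L_j` deforming `Li_{(s_0, …, s_{j-1})}(u_0, …, u_{j-1})`: it satisfies `L_0 = 1` and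
`L_{j+1} = Ω^{s_j} u_j L_j⁽¹⁾ + L_{j+1}⁽¹⁾`. -/
noncomputable def polylogSeries (θ' : CInf F) (s : ℕ → ℕ) (u : ℕ → CInf F) :
    ℕ → PowerSeries (CInf F)
  | 0 => 1
  | j + 1 => twistedFixedPoint (frobHom F) (omegaSeries θ' ^ s j * PowerSeries.C (u j) *
      PowerSeries.map (frobHom F) (polylogSeries θ' s u j)) 1 0

/-- The Gauss norm of `Ω^{s_k} u_k` on the disc of radius `q`. -/
noncomputable def polylogFactorNorm (θ' : CInf F) (s : ℕ → ℕ) (u : ℕ → CInf F) (k : ℕ) : ℝ :=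
  ‖(θ' ^ Fintype.card F)⁻¹‖ ^ s k * ‖u k‖

/-- A bound for the Gauss norm of `polylogSeries θ' s u j` on the disc of radius `q`. -/
noncomputable def polylogBound (θ' : CInf F) (s : ℕ → ℕ) (u : ℕ → CInf F) (j : ℕ) : ℝ :=
  ∏ k ∈ Finset.range j, polylogFactorNorm θ' s u k ^ Fintype.card F ^ (j - 1 - k)

variable {θ' : CInf F} {s : ℕ → ℕ} {u : ℕ → CInf F}

theorem polylogFactorNorm_nonneg (k : ℕ) : 0 ≤ polylogFactorNorm θ' s u k := by
  rw [polylogFactorNorm]; positivity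

theorem polylogBound_nonneg (j : ℕ) : 0 ≤ polylogBound θ' s u j :=
  Finset.prod_nonneg fun k _ => pow_nonneg (polylogFactorNorm_nonneg k) _

theorem polylogBound_succ (j : ℕ) : polylogBound θ' s u (j + 1) =
    polylogFactorNorm θ' s u j * polylogBound θ' s u j ^ Fintype.card F := by
  rw [polylogBound, polylogBound, Finset.prod_range_succ, mul_comm, ← Finset.prod_pow]
  congr 1
  · simp
  · refine Finset.prod_congr rfl fun k hk => ?_
    have := Finset.mem_range.1 hk
    rw [← pow_mul, ← pow_succ]
    congr 2
    omega

variable (hθ' : θ' ^ (Fintype.card F - 1) = -theta F)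
include hθ'

section Spec

variable {r : ℕ} (hM : ∀ j < r, polylogBound θ' s u (j + 1) < 1)
include hM

theorem polylogSeries_succ_spec {j : ℕ} (hj : j < r)
    (hb : GaussBound (Fintype.card F) (polylogBound θ' s u j) (polylogSeries θ' s u j)) :
    twistedAffine (frobHom F) (omegaSeries θ' ^ s j * PowerSeries.C (u j) *
      PowerSeries.map (frobHom F) (polylogSeries θ' s u j)) 1 (polylogSeries θ' s u (j + 1)) =
        polylogSeries θ' s u (j + 1) ∧
    GaussBound (Fintype.card F) (polylogBound θ' s u (j + 1)) (polylogSeries θ' s u (j + 1)) ∧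
    ∀ n, Tendsto (fun N => PowerSeries.coeff n
      ((twistedAffine (frobHom F) (omegaSeries θ' ^ s j * PowerSeries.C (u j) *
        PowerSeries.map (frobHom F) (polylogSeries θ' s u j)) 1)^[N] 0)) atTop
        (𝓝 (PowerSeries.coeff n (polylogSeries θ' s u (j + 1)))) := by
  have hq := Fintype.one_lt_card (α := F)
  have hq1 := one_lt_card_real (F := F)
  have hq0 : (0 : ℝ) ≤ Fintype.card F := by positivity
  have hh : GaussBound (Fintype.card F) (polylogBound θ' s u (j + 1))
      (omegaSeries θ' ^ s j * PowerSeries.C (u j) *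
        PowerSeries.map (frobHom F) (polylogSeries θ' s u j)) := by
    rw [polylogBound_succ]
    exact (((gaussBound_omegaSeries hθ').pow hq0 _).mul hq0 (GaussBound.C _)).mul hq0
      (hb.map_same (norm_frobHom F) Fintype.card_ne_zero hq1.le)
  have hA : GaussBound (Fintype.card F : ℝ) 1 (1 : PowerSeries (CInf F)) := by
    simpa using GaussBound.C (R := (Fintype.card F : ℝ)) (1 : CInf F)
  have hD : GaussBound (Fintype.card F) (polylogBound θ' s u (j + 1))
      (twistedAffine (frobHom F) (omegaSeries θ' ^ s j * PowerSeries.C (u j) *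
        PowerSeries.map (frobHom F) (polylogSeries θ' s u j)) 1 0 - 0) := by
    rw [twistedAffine, map_zero, mul_zero, add_zero, sub_zero]
    exact hh
  obtain ⟨h1, h2, h3⟩ := twistedFixedPoint_spec (norm_frobHom F) hq hq1.le hA hD
    (by rw [one_mul]; exact pow_lt_one₀ (polylogBound_nonneg _) (hM j hj) (by omega))
  refine ⟨h1, ?_, h3⟩
  have h0 := h2 0
  rwa [pow_zero, mul_one, Function.iterate_zero, id, sub_zero] at h0

theorem gaussBound_polylogSeries {j : ℕ} (hj : j ≤ r) :
    GaussBound (Fintype.card F) (polylogBound θ' s u j) (polylogSeries θ' s u j) := by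
  induction j with
  | zero => simpa [polylogSeries, polylogBound] using
      GaussBound.C (R := (Fintype.card F : ℝ)) (1 : CInf F)
  | succ j ih => exact (polylogSeries_succ_spec hθ' hM hj (ih (by omega))).2.1

theorem polylogSeries_twistedAffine {j : ℕ} (hj : j < r) :
    twistedAffine (frobHom F) (omegaSeries θ' ^ s j * PowerSeries.C (u j) *
      PowerSeries.map (frobHom F) (polylogSeries θ' s u j)) 1 (polylogSeries θ' s u (j + 1)) =
        polylogSeries θ' s u (j + 1) :=
  (polylogSeries_succ_spec hθ' hM hj (gaussBound_polylogSeries hθ' hM hj.le)).1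

theorem polylogSeries_succ_eq {j : ℕ} (hj : j < r) :
    omegaSeries θ' ^ s j * PowerSeries.C (u j) *
      PowerSeries.map (frobHom F) (polylogSeries θ' s u j) +
        PowerSeries.map (frobHom F) (polylogSeries θ' s u (j + 1)) =
      polylogSeries θ' s u (j + 1) := by
  conv_rhs => rw [← polylogSeries_twistedAffine hθ' hM hj]
  rw [twistedAffine, one_mul]

theorem gaussFinite_polylogSeries {j : ℕ} (hj : j ≤ r) : GaussFinite (polylogSeries θ' s u j) := by
  induction j with
  | zero => exact GaussFinite.one
  | succ j ih =>
    exact GaussFinite.of_twistedAffine_eq (norm_frobHom F) Fintype.one_lt_card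
      ((((gaussFinite_omegaSeries hθ').pow _).mul (GaussFinite.C _)).mul
        (ih (by omega)).map_frobHom) GaussFinite.one (polylogSeries_twistedAffine hθ' hM hj)
      one_lt_card_real (gaussBound_polylogSeries hθ' hM hj)

theorem coeffsIn_kBar_polylogSeries (hu : ∀ k < r, u k ∈ kBar F) {j : ℕ} (hj : j ≤ r) :
    CoeffsIn (kBar F).toSubring (polylogSeries θ' s u j) := by
  induction j with
  | zero => exact CoeffsIn.one
  | succ j ih =>
    exact CoeffsIn.of_twistedAffine_eq (fun _ => frobHom_mem_kBar)
      (fun _ hα _ hβ _ hx => mem_kBar_of_eq_add_mul_pow Fintype.one_lt_card hα hβ hx)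
      ((((coeffsIn_kBar_omegaSeries hθ').pow _).mul (CoeffsIn.C (hu j hj))).mul
        ((ih (by omega)).map fun _ => frobHom_mem_kBar)) CoeffsIn.one
      (polylogSeries_twistedAffine hθ' hM hj)

theorem coeffsIn_polylogSeries (K : IntermediateField (KInf F) (CInf F))
    [FiniteDimensional (KInf F) K] (hK : θ' ∈ K) (hu : ∀ k < r, u k ∈ K) {j : ℕ} (hj : j ≤ r) :
    CoeffsIn K.toSubring (polylogSeries θ' s u j) := by
  induction j with
  | zero => exact CoeffsIn.one
  | succ j ih =>
    intro n
    refine (isClosed_of_finiteDimensional K).mem_of_tendsto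
      ((polylogSeries_succ_spec hθ' hM hj (gaussBound_polylogSeries hθ' hM (by omega))).2.2 n)
      (Eventually.of_forall fun N => ?_)
    exact CoeffsIn.twistedAffine_iterate (S := K.toSubring) (fun _ => frobHom_mem K)
      ((((coeffsIn_omegaSeries hθ' K hK).pow _).mul (CoeffsIn.C (S := K.toSubring) (hu j hj))).mul
        ((ih (by omega)).map fun _ => frobHom_mem K)) CoeffsIn.one CoeffsIn.zero N n

theorem evalAt_polylogSeries_theta_pow {j : ℕ} (hj : j < r) (hs : s j ≠ 0) (N : ℕ) :
    evalAt (polylogSeries θ' s u (j + 1)) (theta F ^ Fintype.card F ^ N) =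
      evalAt (polylogSeries θ' s u (j + 1)) (theta F) ^ Fintype.card F ^ N := by
  induction N with
  | zero => simp
  | succ N ih =>
    have hΩ := gaussFinite_omegaSeries hθ'
    have hL := (gaussFinite_polylogSeries hθ' hM hj.le).map_frobHom
    have hL' := gaussFinite_polylogSeries hθ' hM (Nat.succ_le_of_lt hj)
    rw [← polylogSeries_succ_eq hθ' hM hj,
      (((hΩ.pow _).mul (GaussFinite.C _)).mul hL).evalAt_add hL'.map_frobHom,
      ((hΩ.pow _).mul (GaussFinite.C _)).evalAt_mul hL, (hΩ.pow _).evalAt_mul (GaussFinite.C _),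
      hΩ.evalAt_pow, evalAt_omegaSeries_theta_pow hθ', zero_pow hs, zero_mul, zero_mul, zero_add,
      polylogSeries_succ_eq hθ' hM hj, pow_succ, pow_mul, pow_mul, hL'.evalAt_map, ih]

/-- The value of `L_r` at `t = θ`. -/
theorem evalAt_polylogSeries
    (hu : Summable (liTerm (fun k : Fin r => s k) (fun k : Fin r => u k))) :
    evalAt (polylogSeries θ' s u r) (theta F) = Omega θ' (theta F) ^ (∑ k : Fin r, s k) *
      Li (fun k : Fin r => s k) (fun k : Fin r => u k) := by
  have hq := Fintype.card_ne_zero (α := F)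
  have hq1 := one_lt_card_real (F := F)
  have hΩ := gaussFinite_omegaSeries hθ'
  set c : ℕ → ℕ → CInf F := fun k i =>
    (Omega θ' (theta F) / ell F i) ^ s k * u k ^ Fintype.card F ^ i with hc
  set A : ℕ → ℕ → CInf F := fun j m =>
    evalAt ((PowerSeries.map (frobHom F))^[m] (polylogSeries θ' s u j)) (theta F) with hAdef
  have h0 : ∀ m, A 0 m = 1 := by
    intro m
    have : (PowerSeries.map (frobHom F))^[m] (1 : PowerSeries (CInf F)) = 1 := iterate_map_one _ m
    simp only [hAdef, polylogSeries, this, evalAt_one]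
  have hitC : ∀ (a : CInf F) (m : ℕ), (PowerSeries.map (frobHom F))^[m] (PowerSeries.C a) =
      PowerSeries.C (a ^ Fintype.card F ^ m) := by
    intro a m
    induction m with
    | zero => simp
    | succ m ih =>
      rw [Function.iterate_succ_apply', ih, PowerSeries.map_C, frobHom_apply, ← pow_mul, ← pow_succ]
  have hA : ∀ j < r, ∀ m, A (j + 1) m = c j m * A j (m + 1) + A (j + 1) (m + 1) := by
    intro j hj m
    have h1 := congrArg (PowerSeries.map (frobHom F))^[m] (polylogSeries_succ_eq hθ' hM hj)
    rw [iterate_map_add, iterate_map_mul, iterate_map_mul, iterate_map_pow, hitC,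
      ← Function.iterate_succ_apply, ← Function.iterate_succ_apply] at h1
    have hΩm := hΩ.map_iterate (norm_frobHom F) hq m
    have hL := (gaussFinite_polylogSeries hθ' hM hj.le).map_iterate (norm_frobHom F) hq (m + 1)
    have hL' := (gaussFinite_polylogSeries hθ' hM (Nat.succ_le_of_lt hj)).map_iterate
      (norm_frobHom F) hq (m + 1)
    simp only [hAdef, hc]
    rw [← h1, (((hΩm.pow _).mul (GaussFinite.C _)).mul hL).evalAt_add hL',
      ((hΩm.pow _).mul (GaussFinite.C _)).evalAt_mul hL, (hΩm.pow _).evalAt_mul (GaussFinite.C _),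
      hΩm.evalAt_pow, evalAt_C, evalAt_iterate_omegaSeries hθ']
  -- The `m`-fold twist has Gauss norm at most the bound raised to `q^m`, and the bound is `< 1`.
  have ht : ∀ j < r, Tendsto (A (j + 1)) atTop (𝓝 0) := by
    intro j hj
    refine squeeze_zero_norm (fun m => ((gaussBound_polylogSeries hθ' hM
      (Nat.succ_le_of_lt hj)).map_iterate (norm_frobHom F) hq hq1.le m).norm_evalAt_le
        (norm_theta F).le) ?_
    exact (tendsto_pow_atTop_nhds_zero_of_lt_one (polylogBound_nonneg _) (hM j hj)).comp
      (tendsto_pow_atTop_atTop_of_one_lt Fintype.one_lt_card)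
  let e : DecIndexGE r 0 ≃ DecIndex r := Equiv.subtypeEquivRight fun i => by simp
  have hterm : ∀ i : DecIndexGE r 0, ∏ k : Fin r, c k (i.1 k) =
      Omega θ' (theta F) ^ (∑ k : Fin r, s k) *
        liTerm (fun k : Fin r => s k) (fun k : Fin r => u k) (e i) := by
    intro i
    simp only [hc, Finset.prod_mul_distrib, div_pow, Finset.prod_div_distrib,
      Finset.prod_pow_eq_pow_sum, liTerm, e, Equiv.subtypeEquivRight_apply_coe]
    ring
  have hsum : Summable fun i : DecIndexGE r 0 => ∏ k : Fin r, c k (i.1 k) := by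
    simp only [hterm]
    exact ((e.summable_iff).2 hu).mul_left _
  have := tsum_decIndexGE_eq h0 hA ht r le_rfl 0 hsum
  simp only [hterm, tsum_mul_left] at this
  rw [e.tsum_eq (liTerm (fun k : Fin r => s k) (fun k : Fin r => u k))] at this
  exact this.symm

end Spec

/-- The `j`-th factor of `𝓛_i` has norm `q^(q^j)`, and `‖a‖^q = ‖a‖ q^(-q)`, so the powers of `q`
cancel step by step. This turns term norms into products of `polylogFactorNorm`. -/
theorem norm_ell (i : ℕ) : ‖ell F i‖ * ‖(θ' ^ Fintype.card F)⁻¹‖ ^ Fintype.card F ^ i =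
    ‖(θ' ^ Fintype.card F)⁻¹‖ := by
  have hq1 := one_lt_card_real (F := F)
  induction i with
  | zero => simp [ell]
  | succ i ih =>
    have h1 : ‖theta F - theta F ^ Fintype.card F ^ (i + 1)‖ =
        (Fintype.card F : ℝ) ^ Fintype.card F ^ (i + 1) := by
      have hlt : ‖theta F‖ < ‖-theta F ^ Fintype.card F ^ (i + 1)‖ := by
        rw [norm_neg, norm_pow, norm_theta]
        exact lt_self_pow₀ hq1 (one_lt_pow₀ Fintype.one_lt_card (by omega))
      rw [sub_eq_add_neg, IsUltrametricDist.norm_add_eq_max_of_norm_ne_norm hlt.ne,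
        max_eq_right hlt.le, norm_neg, norm_pow, norm_theta]
    rw [ell, Finset.prod_Icc_succ_top (by omega), ← ell, norm_mul, h1, pow_succ', pow_mul,
      pow_mul ‖(θ' ^ Fintype.card F)⁻¹‖, norm_inv_thetaRoot_pow_card hθ', mul_pow, inv_pow]
    rw [mul_comm (_ ^ _) (_⁻¹), ← mul_assoc, mul_assoc ‖ell F i‖, mul_inv_cancel₀ (by positivity),
      mul_one, ih]

theorem norm_liTerm {r : ℕ} (i : DecIndex r) :
    ‖liTerm (fun k : Fin r => s k) (fun k : Fin r => u k) i‖ *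
        ‖(θ' ^ Fintype.card F)⁻¹‖ ^ (∑ k : Fin r, s k) =
      ∏ k : Fin r, polylogFactorNorm θ' s u k ^ Fintype.card F ^ i.1 k := by
  have hne : ∀ j, ‖ell F j‖ ≠ 0 := fun j => norm_ne_zero_iff.2 (ell_ne_zero j)
  rw [liTerm, norm_div, norm_prod, norm_prod, ← Finset.prod_pow_eq_pow_sum,
    ← Finset.prod_div_distrib, ← Finset.prod_mul_distrib]
  refine Finset.prod_congr rfl fun k _ => ?_
  conv_lhs => rw [← norm_ell hθ' (i.1 k)]
  rw [norm_pow, norm_pow, mul_pow, polylogFactorNorm, mul_pow, pow_right_comm]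
  have := hne (i.1 k)
  field_simp

/-- Convergence of the polylogarithm forces the bounds `polylogBound` to be `< 1`. -/
theorem polylogBound_lt_one {r : ℕ} (hu0 : ∀ k < r, u k ≠ 0)
    (hu : Summable (liTerm (fun k : Fin r => s k) (fun k : Fin r => u k))) {j : ℕ} (hj : j < r) :
    polylogBound θ' s u (j + 1) < 1 := by
  have hq1 := one_lt_card_real (F := F)
  -- Start from the smallest index `(r-1, …, 1, 0)` and shift its first `j + 1` entries by `m`. The
  -- term norm is then, up to a constant, a power of `polylogBound` times a positive constant `C`.
  let i : ℕ → DecIndex r := fun m =>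
    ⟨fun k => (if (k : ℕ) ≤ j then m else 0) + (r - 1 - k), fun k l hkl => by
      have h1 : (k : ℕ) < l := hkl
      have h2 := l.2
      dsimp only
      split_ifs <;> omega⟩
  have hi : Function.Injective i := by
    intro m n hmn
    have := congrFun (congrArg Subtype.val hmn) ⟨0, by omega⟩
    simpa [i] using this
  have hterm : ∀ m, ∏ k : Fin r, polylogFactorNorm θ' s u k ^ Fintype.card F ^ (i m).1 k =
      polylogBound θ' s u (j + 1) ^ Fintype.card F ^ (m + (r - (j + 1))) *
        ∏ k ∈ Finset.Ico (j + 1) r, polylogFactorNorm θ' s u k ^ Fintype.card F ^ (r - 1 - k) := by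
    intro m
    rw [Finset.prod_fin_eq_prod_range, ← Finset.prod_range_mul_prod_Ico _ (Nat.succ_le_of_lt hj),
      polylogBound, ← Finset.prod_pow]
    congr 1
    · refine Finset.prod_congr rfl fun k hk => ?_
      have hk := Finset.mem_range.1 hk
      rw [dif_pos (by omega), ← pow_mul, ← pow_add]
      congr 2
      simp only [i]
      rw [if_pos (by omega)]
      omega
    · refine Finset.prod_congr rfl fun k hk => ?_
      have hk := Finset.mem_Ico.1 hk
      rw [dif_pos hk.2]
      congr 2
      simp only [i]
      rw [if_neg (by omega), zero_add]
  have hfac : ∀ k < r, 0 < polylogFactorNorm θ' s u k := fun k hk => by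
    have h1 := norm_pos_iff.2 (hu0 k hk)
    have h2 := norm_pos_iff.2 (inv_ne_zero (pow_ne_zero (Fintype.card F) (thetaRoot_ne_zero hθ')))
    rw [polylogFactorNorm]
    positivity
  set C := ∏ k ∈ Finset.Ico (j + 1) r, polylogFactorNorm θ' s u k ^ Fintype.card F ^ (r - 1 - k)
  have hC : 0 < C := Finset.prod_pos fun k hk => pow_pos (hfac k (Finset.mem_Ico.1 hk).2) _
  have ht := ((hu.tendsto_cofinite_zero.comp hi.tendsto_cofinite).norm).mul_const
    (‖(θ' ^ Fintype.card F)⁻¹‖ ^ (∑ k : Fin r, s k))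
  rw [norm_zero, zero_mul, Nat.cofinite_eq_atTop] at ht
  simp only [Function.comp_def, norm_liTerm hθ', hterm] at ht
  by_contra! hge
  refine hC.not_ge (ge_of_tendsto' ht fun m => ?_)
  exact le_mul_of_one_le_left hC.le (one_le_pow₀ hge)

end Polylog

/-! ### The difference system of a polylogarithm -/

section System

variable {F : Type*} [Field F] [Fintype F]

/-- The matrix with diagonal entries `(t - θ)^{S_i}`, `S_i = s_i + ⋯ + s_{r-1}`, and subdiagonal
entries `v_i (t - θ)^{S_i}`. -/
noncomputable def polylogMatrix (r : ℕ) (s : ℕ → ℕ) (v : ℕ → CInf F) :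
    Matrix (Fin (r + 1)) (Fin (r + 1)) (Polynomial (CInf F)) := fun i j =>
  if i = j then (Polynomial.X - Polynomial.C (theta F)) ^ (∑ k ∈ Finset.Ico (j : ℕ) r, s k)
  else if (i : ℕ) = j + 1 then Polynomial.C (v j) *
    (Polynomial.X - Polynomial.C (theta F)) ^ (∑ k ∈ Finset.Ico (j : ℕ) r, s k)
  else 0

/-- The vector with entries `Ω^{S_i} L_i`, `S_i = s_i + ⋯ + s_{r-1}`. -/
noncomputable def polylogVector (θ' : CInf F) (r : ℕ) (s : ℕ → ℕ) (u : ℕ → CInf F) :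
    Fin (r + 1) → PowerSeries (CInf F) := fun i =>
  omegaSeries θ' ^ (∑ k ∈ Finset.Ico (i : ℕ) r, s k) * polylogSeries θ' s u i

theorem coeff_polylogMatrix_mem {r : ℕ} {s : ℕ → ℕ} {v : ℕ → CInf F}
    (hv : ∀ k < r, v k ∈ kBar F) (i j : Fin (r + 1)) (m : ℕ) :
    (polylogMatrix r s v i j).coeff m ∈ kBar F := by
  have hX : ∀ n : ℕ, CoeffsIn (kBar F).toSubring
      ((PowerSeries.X - PowerSeries.C (theta F)) ^ n) := fun n =>
    (CoeffsIn.X.sub (CoeffsIn.C (S := (kBar F).toSubring) theta_mem_kBar)).pow n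
  have hco : ∀ n : ℕ, (((Polynomial.X - Polynomial.C (theta F)) ^ n : Polynomial (CInf F)) :
      PowerSeries (CInf F)) = (PowerSeries.X - PowerSeries.C (theta F)) ^ n := by
    intro n; simp
  rw [polylogMatrix]
  split_ifs with h1 h2
  · rw [← Polynomial.coeff_coe, hco]
    exact hX _ m
  · rw [← Polynomial.coeff_coe, Polynomial.coe_mul, hco, Polynomial.coe_C]
    exact ((CoeffsIn.C (S := (kBar F).toSubring) (hv j (by omega))).mul (hX _)) m
  · rw [Polynomial.coeff_zero]
    exact zero_mem _

theorem det_polylogMatrix (r : ℕ) (s : ℕ → ℕ) (v : ℕ → CInf F) :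
    (polylogMatrix r s v).det = (Polynomial.X - Polynomial.C (theta F)) ^
      (∑ i : Fin (r + 1), ∑ k ∈ Finset.Ico (i : ℕ) r, s k) := by
  rw [Matrix.det_of_isLowerTriangular]
  · simp [polylogMatrix, Finset.prod_pow_eq_pow_sum]
  · intro i j hij
    have : i < j := hij
    rw [polylogMatrix, if_neg this.ne, if_neg (by omega)]

variable {θ' : CInf F} (hθ' : θ' ^ (Fintype.card F - 1) = -theta F)
include hθ'

theorem twist_polylogVector {r : ℕ} {s : ℕ → ℕ} {u v : ℕ → CInf F}
    (hM : ∀ j < r, polylogBound θ' s u (j + 1) < 1) (hv : ∀ k, v k ^ Fintype.card F = u k) :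
    (fun i => twist (-1) (polylogVector θ' r s u i)) =
      ((polylogMatrix r s v).map fun p => (p : PowerSeries (CInf F))).mulVec
        (polylogVector θ' r s u) := by
  have hXΩ : ∀ n : ℕ, PowerSeries.map (frobHom F) ((PowerSeries.X - PowerSeries.C (theta F)) ^ n) *
      PowerSeries.map (frobHom F) (omegaSeries θ') ^ n = omegaSeries θ' ^ n := by
    intro n
    rw [map_pow, map_sub, PowerSeries.map_X, PowerSeries.map_C, frobHom_apply, ← mul_pow,
      omegaSeries_eq hθ']
  have hco : ∀ n : ℕ, (((Polynomial.X - Polynomial.C (theta F)) ^ n : Polynomial (CInf F)) :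
      PowerSeries (CInf F)) = (PowerSeries.X - PowerSeries.C (theta F)) ^ n := by
    intro n; simp
  ext1 i
  -- It suffices to check `ψ = (Φ ψ)⁽¹⁾`, which uses the functional equations as they stand.
  refine Eq.trans (congrArg (twist (-1)) ?_) (twist_neg_one_map _)
  rw [Matrix.mulVec, dotProduct]
  simp only [Matrix.map_apply]
  induction i using Fin.cases with
  | zero =>
    rw [Fintype.sum_eq_single 0 fun j hj => by
      rw [polylogMatrix, if_neg hj.symm, if_neg (by simp), Polynomial.coe_zero, zero_mul]]
    rw [polylogMatrix, if_pos rfl, hco, polylogVector, map_mul, map_mul, map_pow _ (omegaSeries θ'),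
      ← mul_assoc, hXΩ]
    simp [polylogSeries]
  | succ i =>
    rw [Fintype.sum_eq_add i.succ i.castSucc (Fin.castSucc_lt_succ).ne' fun j hj => by
      rw [polylogMatrix, if_neg hj.1.symm, if_neg fun h => hj.2 (Fin.ext (by simp at h ⊢; omega)),
        Polynomial.coe_zero, zero_mul]]
    rw [polylogMatrix, if_pos rfl, polylogMatrix, if_neg (Fin.castSucc_lt_succ).ne',
      if_pos (by simp), Polynomial.coe_mul, hco, hco, Polynomial.coe_C, map_add]
    simp only [polylogVector, map_mul, map_pow _ (omegaSeries θ')]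
    rw [← mul_assoc, hXΩ, PowerSeries.map_C, frobHom_apply, hv]
    rw [Fin.val_succ, Fin.val_castSucc]
    have hsum : ∑ k ∈ Finset.Ico (i : ℕ) r, s k = s i + ∑ k ∈ Finset.Ico (i + 1 : ℕ) r, s k :=
      Finset.sum_eq_sum_Ico_succ_bot i.2 _
    have h2 := hXΩ (∑ k ∈ Finset.Ico (i : ℕ) r, s k)
    have h3 := polylogSeries_succ_eq hθ' hM i.2
    conv_lhs => rw [← h3]
    generalize PowerSeries.map (frobHom F) (polylogSeries θ' s u (i + 1)) = L' at *
    generalize PowerSeries.map (frobHom F) (polylogSeries θ' s u i) = L at *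
    calc _ = omegaSeries θ' ^ (∑ k ∈ Finset.Ico (i + 1 : ℕ) r, s k) * L' + PowerSeries.C (u i) *
          omegaSeries θ' ^ (∑ k ∈ Finset.Ico (i : ℕ) r, s k) * L := by rw [hsum, pow_add]; ring
      _ = _ := by rw [← h2]; ring

theorem hasMZProperty_Li {r : ℕ} (hr : 1 ≤ r) {s : ℕ → ℕ} (hs : ∀ k < r, 1 ≤ s k)
    {u : ℕ → CInf F} (hu : Summable (liTerm (fun k : Fin r => s k) (fun k : Fin r => u k)))
    (hu_alg : ∀ k < r, u k ∈ kBar F) (hu_ne : ∀ k < r, u k ≠ 0)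
    (hLi : Li (fun k : Fin r => s k) (fun k : Fin r => u k) ≠ 0) :
    HasMZProperty θ' (∑ k : Fin r, s k) (Li (fun k : Fin r => s k) (fun k : Fin r => u k)) := by
  have hM : ∀ j < r, polylogBound θ' s u (j + 1) < 1 := fun j hj =>
    polylogBound_lt_one hθ' hu_ne hu hj
  have hΩ := gaussFinite_omegaSeries hθ'
  have hL : ∀ i : Fin (r + 1), GaussFinite (polylogSeries θ' s u i) := fun i =>
    gaussFinite_polylogSeries hθ' hM (Nat.le_of_lt_succ i.2)
  -- The `q`-th roots of the `u_k` enter only `Φ`, so they need to lie in `k̄` but not in the finite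
  -- extension `K`.
  choose v hv using fun k => (frobHom_bijective F).2 (u k)
  simp only [frobHom_apply] at hv
  let K : IntermediateField (KInf F) (CInf F) :=
    IntermediateField.adjoin (KInf F) (insert θ' (Set.range fun k : Fin r => u k))
  have hKsub : insert θ' (Set.range fun k : Fin r => u k) ⊆ (K : Set (CInf F)) :=
    IntermediateField.subset_adjoin _ _
  have hθK : θ' ∈ K := hKsub (Set.mem_insert _ _)
  have huK : ∀ k < r, u k ∈ K := fun k hk => hKsub (Set.mem_insert_of_mem _ ⟨⟨k, hk⟩, rfl⟩)
  have hKfin : FiniteDimensional (KInf F) K := by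
    have : Finite (insert θ' (Set.range fun k : Fin r => u k) : Set (CInf F)) :=
      ((Set.finite_range _).insert _).to_subtype
    refine IntermediateField.finiteDimensional_adjoin fun x hx => ?_
    rcases hx with rfl | ⟨k, rfl⟩
    · exact isIntegral_of_mem_kBar (thetaRoot_mem_kBar hθ')
    · exact isIntegral_of_mem_kBar (hu_alg k k.2)
  -- The finite partial sums lie in `K`, which is closed; hence the value is algebraic over `k_∞`.
  have hLiK : Li (fun k : Fin r => s k) (fun k : Fin r => u k) ∈ K := by
    refine (isClosed_of_finiteDimensional K).mem_of_tendsto hu.hasSum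
      (Eventually.of_forall fun t => sum_mem fun i _ => div_mem (prod_mem fun k _ =>
        pow_mem (huK k k.2) _) (prod_mem fun k _ => pow_mem (prod_mem fun j _ => sub_mem
          (theta_mem K) (pow_mem (theta_mem K) _)) _))
  have hperiod : ∀ n : ℕ, 1 / carlitzPeriod θ' ^ n = Omega θ' (theta F) ^ n := fun n => by
    rw [carlitzPeriod, one_div, one_div, inv_pow, inv_inv]
  have hlast : evalAt (polylogSeries θ' s u r) (theta F) = algebraMap (RatFunc F) (CInf F) 1 *
      Li (fun k : Fin r => s k) (fun k : Fin r => u k) /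
        carlitzPeriod θ' ^ (∑ k : Fin r, s k) := by
    rw [evalAt_polylogSeries hθ' hM hu, map_one, one_mul, ← hperiod, one_div, div_eq_inv_mul]
  have hψlast : polylogVector θ' r s u (Fin.last r) = polylogSeries θ' s u r := by
    simp [polylogVector]
  refine ⟨hLi, mem_range_of_isIntegral (K.isIntegral_iff.1 (Algebra.IsIntegral.isIntegral
    (⟨_, hLiK⟩ : K))), r, hr, polylogMatrix r s v, polylogVector θ' r s u, 1, ?_⟩
  refine ⟨coeff_polylogMatrix_mem fun k hk => mem_kBar_of_pow_mem Fintype.card_pos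
    (hv k ▸ hu_alg k hk), fun i => ?_, twist_polylogVector hθ' hM hv,
    ⟨1, one_mem _, one_ne_zero, _, by rw [det_polylogMatrix, map_one, one_mul]⟩, fun i => ?_,
    one_ne_zero, ?_, ?_, fun N hN i => ?_⟩
  · have hi := Nat.le_of_lt_succ i.2
    exact ((hΩ.pow _).mul (hL i)).isEntire
      (((coeffsIn_kBar_omegaSeries hθ').pow _).mul
        (coeffsIn_kBar_polylogSeries hθ' hM hu_alg hi))
      (((coeffsIn_omegaSeries hθ' K hθK).pow _).mul
        (coeffsIn_polylogSeries hθ' hM K hθK huK hi))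
  · rw [polylogMatrix]
    split_ifs with h1 h2
    · simp
    · have := i.2
      simp only [Fin.val_last] at h2
      omega
    · rfl
  · rw [polylogVector, (hΩ.pow _).evalAt_mul (hL 0), hΩ.evalAt_pow, evalAt_omegaSeries hθ',
      hperiod, Fin.val_zero, polylogSeries, evalAt_one, mul_one, ← Finset.range_eq_Ico,
      Finset.sum_range]
  · rw [hψlast, hlast]
  · split_ifs with h
    · obtain ⟨j, rfl⟩ := Nat.exists_eq_add_of_le' hr
      rw [h, hψlast, ← hlast, evalAt_polylogSeries_theta_pow hθ' hM (Nat.lt_succ_self j)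
        (by have := hs j (Nat.lt_succ_self j); omega)]
    · obtain ⟨M, rfl⟩ := Nat.exists_eq_add_of_le' hN
      have hi : (i : ℕ) < r := Fin.val_lt_last h
      rw [polylogVector, (hΩ.pow _).evalAt_mul (hL i), hΩ.evalAt_pow,
        evalAt_omegaSeries_theta_pow hθ', zero_pow, zero_mul]
      -- For `i < r` the exponent `S_i` contains `s_i ≥ 1`, so the zero of `Ω` survives.
      rw [Finset.sum_eq_sum_Ico_succ_bot hi]
      have := hs i hi
      omega

end System

end CarlitzMZ

theorem proposition5 (F : Type*) [Field F] [Fintype F]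
    (θ' : CarlitzMZ.CInf F) (hθ' : θ' ^ (Fintype.card F - 1) = -CarlitzMZ.theta F)
    (r : ℕ) (hr : 1 ≤ r) (s : Fin r → ℕ) (hs : ∀ i, 1 ≤ s i)
    (u : Fin r → CarlitzMZ.CInf F) (hu : u ∈ CarlitzMZ.convDomain s)
    (hu_alg : ∀ i, u i ∈ CarlitzMZ.kBar F) (hu_ne : ∀ i, u i ≠ 0)
    (hLi : CarlitzMZ.Li s u ≠ 0) :
    CarlitzMZ.HasMZProperty θ' (∑ i, s i) (CarlitzMZ.Li s u) := by
  -- The recursion on depth runs over families indexed by `ℕ`; the values `0` beyond `r` play no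
  -- role.
  obtain ⟨s, rfl⟩ : ∃ s' : ℕ → ℕ, s = fun k : Fin r => s' k :=
    ⟨fun k => if h : k < r then s ⟨k, h⟩ else 0, by ext k; simp⟩
  obtain ⟨u, rfl⟩ : ∃ u' : ℕ → CarlitzMZ.CInf F, u = fun k : Fin r => u' k :=
    ⟨fun k => if h : k < r then u ⟨k, h⟩ else 0, by ext k; simp⟩
  exact CarlitzMZ.hasMZProperty_Li hθ' hr (fun k hk => hs ⟨k, hk⟩) hu
    (fun k hk => hu_alg ⟨k, hk⟩) (fun k hk => hu_ne ⟨k, hk⟩) hLi
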